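/- Let $r\ge 1$ and $n\ge r$, and consider the single-input system in normal form $$\dot z=f(z,\xi_1),\qquad \dot\xi_i=\xi_{i+1}\ (1\le i\le r-1),\qquad \dot\xi_r=\bar q(z,\xi)+\bar b(z,\xi)u,$$ with $z\in\mathbb R^{n-r}$, $\xi=(\xi_1,\dots,\xi_r)\in\mathbb R^r$, $f,\bar q,\bar b$ locally Lipschitz and $\bar b(z,\xi)\ge b_0>0$ everywhere. Assume that the system is minimum-phase, i.e. $z=0$ is a globally asymptotically stable equilibrium of $\dot z=f(z,0)$. *Quantizers.* For $\delta\in(0,1)$, $u_0>0$, $j\in\mathbb N$ put $\rho=\frac{1-\delta}{1+\delta}$, $u_i=\rho^iu_0$. The logarithmic quantizer is $\Psi(v)=u_i$ if $\frac{u_i}{1+\delta}<v\le\frac{u_i}{1-\delta}$ for some $0\le i\le j$, $\Psi(v)=0$ if $0\le v\le\frac{u_j}{1+\delta}$, and $\Psi(v)=-\Psi(-v)$ for $v<0$; its range is $|v|\le\frac{u_0}{1-\delta}$ (the values outside the range play no role, and are set to $\pm u_0$). The quantizer with hysteresis $\Psi_m$ takes the values $0,\pm u_i,\pm\frac{u_i}{1+\delta}$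 ($0\le i\le j$). It is piecewise constant and left continuous in time, starts at $\Psi_m(v(0))=\Psi(v(0))$, and keeps its value until the input $v(t)$ triggers one of the following transitions, or the transition obtained from one of them by changing the signs of both values and of the trigger: $u_i\to\frac{u_i}{1+\delta}$ at $v=\frac{u_i}{1+\delta}$ and $\frac{u_i}{1+\delta}\to u_i$ at $v=\frac{u_i}{1-\delta^2}$ for $0\le i\le j$; $\frac{u_i}{1+\delta}\to u_{i+1}$ at $v=\frac{u_i}{(1+\delta)^2}$ and $u_{i+1}\to\frac{u_i}{1+\delta}$ at $v=\frac{u_i}{1+\delta}$ for $0\le i<j$; $\frac{u_j}{1+\delta}\to0$ at $v=\frac{u_j}{(1+\delta)^2}$ and $0\to\frac{u_j}{1+\delta}$ at $v=\frac{u_j}{1+\delta}$. *Ternary feedback.* For $\bar k,\eta>0$, $u(t)\in\{-\bar k,0,\bar k\}$ is piecewise constant and left continuous. Initially $u(0)=-\bar k$ if $\zeta(0)\ge\eta$, $u(0)=\bar k$ if $\zeta(0)\le-\eta$, $u(0)=0$ otherwise. Then $u$ switches from $0$ to $-\bar k$ when $\zeta\ge\eta$, from $0$ to $\bar k$ when $\zeta\le-\eta$,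 from $-\bar k$ to $0$ when $\zeta\le\eta/2$, and from $\bar k$ to $0$ when $\zeta\ge-\eta/2$. *Claim.* For every $R>0$ there is a row vector $a\in\mathbb R^{r-1}$, depending on $R$, such that every solution of $$\dot z=f(z,\xi_1),\quad\dot\xi_i=\xi_{i+1}\ (1\le i\le r-2),\quad\dot\xi_{r-1}=-a\,(\xi_1,\dots,\xi_{r-1})^T$$ (for $r=1$: of $\dot z=f(z,0)$) starting in the closed cube of $\mathbb R^{n-1}$ of side $2R$ centered at the origin exists for all $t\ge 0$ and converges to the origin, and such that, with $\zeta=a\,(\xi_1,\dots,\xi_{r-1})^T+\xi_r$, for every $\varepsilon>0$ each of the following three kinds of feedback can be chosen, together with a time $T>0$, so that all trajectories of the closed loop which start in the closed cube of $\mathbb R^n$ of side $2R$ centered at the origin stay in a common bounded set as long as they exist, and lie in the closed cube of side $2\varepsilon$ centered at the origin at all times $t\ge T$: 1. for each $\delta\in(0,1)$, a feedback $u=-\Psi(\bar k\zeta)$, with $\bar k,u_0>0$ and $j\in\mathbb N$; trajectories are Krasowskii solutions, and satisfy $|\bar k\zeta(t)|<\frac{u_0}{1-\delta}$ at all times; 2.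 for each $\delta\in(0,1)$, a feedback $u=-\Psi_m(\bar k\zeta)$, with $\bar k,u_0>0$ and $j\in\mathbb N$; again $|\bar k\zeta(t)|<\frac{u_0}{1-\delta}$ at all times along the trajectories; 3. a ternary feedback, with $\bar k,\eta>0$. Here trajectories are absolutely continuous on compact intervals and may be given on any interval $[0,\tau)$ with $\tau\le\infty$. -/

import Mathlib

open Set Filter Topology MeasureTheory

namespace QuantizedControl

/-! ### States, cubes, systems in normal form -/

/-- Points `(z, ξ)` with `z ∈ ℝᵐ` and `ξ ∈ ℝᵏ`. -/
abbrev State (m k : ℕ) : Type := (Fin m → ℝ) × (Fin k → ℝ)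

/-- The closed cube of side `2R` centred at the origin. -/
def cube {m k : ℕ} (R : ℝ) : Set (State m k) :=
  {p | (∀ i, |p.1 i| ≤ R) ∧ ∀ i, |p.2 i| ≤ R}

/-- The right-hand side of the system in normal form of relative degree `r = s + 1`:
`ż = f(z, ξ₁)`, `ξ̇ᵢ = ξᵢ₊₁` for `1 ≤ i ≤ r - 1`, `ξ̇ᵣ = q(z, ξ) + b(z, ξ) u`.
The coordinates `ξ₁, …, ξᵣ` are `p.2 0, …, p.2 (Fin.last s)`. -/
def normalForm {m s : ℕ} (f : (Fin m → ℝ) × ℝ → (Fin m → ℝ))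
    (q b : State m (s + 1) → ℝ) (p : State m (s + 1)) (u : ℝ) : State m (s + 1) :=
  (f (p.1, p.2 0), Fin.snoc (α := fun _ => ℝ) (fun i : Fin s => p.2 i.succ) (q p + b p * u))

/-- The scalar measurement `ζ = aξ + ξᵣ = ∑ aᵢ ξᵢ + ξᵣ`, the sum over `1 ≤ i ≤ r - 1`. -/
def zeta {m s : ℕ} (a : Fin s → ℝ) (p : State m (s + 1)) : ℝ :=
  ∑ i : Fin s, a i * p.2 i.castSucc + p.2 (Fin.last s)

/-- The system that remains when `ξᵣ = -aξ`, in the variables `z, ξ₁, …, ξᵣ₋₁`: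
`ż = f(z, ξ₁)`, `ξ̇ᵢ = ξᵢ₊₁` for `i ≤ r - 2`, `ξ̇ᵣ₋₁ = -aξ`
(for `r = 1` this is `ż = f(z, 0)`). -/
def reducedField {m s : ℕ} (f : (Fin m → ℝ) × ℝ → (Fin m → ℝ)) (a : Fin s → ℝ)
    (p : State m s) : State m s :=
  let ξ : Fin (s + 1) → ℝ := Fin.snoc (α := fun _ => ℝ) p.2 (-∑ i, a i * p.2 i)
  (f (p.1, ξ 0), fun i => ξ i.succ)

/-! ### Asymptotic stability -/

section Stability

variable {E : Type*} [NormedAddCommGroup E] [NormedSpace ℝ E]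

/-- `x` is a (classical) solution of `ẋ = F(x)` on `[0, ∞)`. -/
def IsForwardSolution (F : E → E) (x : ℝ → E) : Prop :=
  ∀ t, 0 ≤ t → HasDerivWithinAt x (F (x t)) (Ici 0) t

/-- From every point of `C` there is a solution on `[0, ∞)`,
and all solutions starting in `C` converge to the origin. -/
def AttractedFrom (F : E → E) (C : Set E) : Prop :=
  (∀ x₀ ∈ C, ∃ x, IsForwardSolution F x ∧ x 0 = x₀) ∧
    ∀ x, IsForwardSolution F x → x 0 ∈ C → Tendsto x atTop (𝓝 0)

/-- The origin is a globally asymptotically stable equilibrium of `ẋ = F(x)`. -/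
structure IsGloballyAsymptoticallyStable (F : E → E) : Prop where
  equilibrium : F 0 = 0
  stable : ∀ ε > 0, ∃ δ > 0, ∀ x, IsForwardSolution F x → ‖x 0‖ < δ → ∀ t, 0 ≤ t → ‖x t‖ < ε
  attractive : AttractedFrom F univ

end Stability

/-- Minimum phase: `z = 0` is a globally asymptotically stable equilibrium of `ż = f(z, 0)`. -/
def IsMinimumPhase {m : ℕ} (f : (Fin m → ℝ) × ℝ → (Fin m → ℝ)) : Prop :=
  IsGloballyAsymptoticallyStable fun z => f (z, 0)

/-! ### The logarithmic quantizer -/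

/-- The quantization levels `uᵢ = ρⁱ u₀`, with `ρ = (1 - δ) / (1 + δ)`. -/
noncomputable def level (δ u₀ : ℝ) (i : ℕ) : ℝ := ((1 - δ) / (1 + δ)) ^ i * u₀

open Classical in
/-- The logarithmic quantizer on `r ≥ 0`. Beyond its range `r ≤ u₀ / (1 - δ)`, where it needs no
definition, it is given the value `u₀`. -/
noncomputable def quantizerPos (δ u₀ : ℝ) (j : ℕ) (r : ℝ) : ℝ :=
  if h : ∃ i ≤ j, level δ u₀ i / (1 + δ) < r ∧ r ≤ level δ u₀ i / (1 - δ) then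
    level δ u₀ h.choose
  else if r ≤ level δ u₀ j / (1 + δ) then 0
  else u₀

/-- The logarithmic quantizer `Ψ`, extended to `r < 0` by `Ψ(r) = -Ψ(-r)`. -/
noncomputable def quantizer (δ u₀ : ℝ) (j : ℕ) (r : ℝ) : ℝ :=
  if 0 ≤ r then quantizerPos δ u₀ j r else -quantizerPos δ u₀ j (-r)

/-- The edges of the transition graph of the multivalued quantizer `Ψ_m`, whose nodes are the values
`0`, `±uᵢ` and `±uᵢ / (1 + δ)`, `0 ≤ i ≤ j`: `HysteresisEdge δ u₀ j v r v'` says that there is an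
edge from the node `v` to the node `v'` and that its guard is satisfied by the input `r`. -/
inductive HysteresisEdge (δ u₀ : ℝ) (j : ℕ) : ℝ → ℝ → ℝ → Prop
  | level_down (i : ℕ) (hi : i ≤ j) :
      HysteresisEdge δ u₀ j (level δ u₀ i) (level δ u₀ i / (1 + δ)) (level δ u₀ i / (1 + δ))
  | mid_up (i : ℕ) (hi : i ≤ j) :
      HysteresisEdge δ u₀ j (level δ u₀ i / (1 + δ)) (level δ u₀ i / (1 - δ ^ 2)) (level δ u₀ i)
  | mid_down (i : ℕ) (hi : i < j) :
      HysteresisEdge δ u₀ j (level δ u₀ i / (1 + δ)) (level δ u₀ i / (1 + δ) ^ 2)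
        (level δ u₀ (i + 1))
  | level_up (i : ℕ) (hi : i < j) :
      HysteresisEdge δ u₀ j (level δ u₀ (i + 1)) (level δ u₀ i / (1 + δ)) (level δ u₀ i / (1 + δ))
  | to_zero :
      HysteresisEdge δ u₀ j (level δ u₀ j / (1 + δ)) (level δ u₀ j / (1 + δ) ^ 2) 0
  | from_zero :
      HysteresisEdge δ u₀ j 0 (level δ u₀ j / (1 + δ)) (level δ u₀ j / (1 + δ))
  | neg {v r v' : ℝ} (h : HysteresisEdge δ u₀ j v r v') : HysteresisEdge δ u₀ j (-v) (-r) (-v')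

/-- The update law of `Ψ_m`: follow an edge whose guard holds; if there is none, keep the value. -/
def hysteresisNext (δ u₀ : ℝ) (j : ℕ) (v r v' : ℝ) : Prop :=
  HysteresisEdge δ u₀ j v r v' ∨ ((¬ ∃ v'', HysteresisEdge δ u₀ j v r v'') ∧ v' = v)

/-! ### The ternary controller -/

/-- The initial value `u(0)` of the ternary control. -/
noncomputable def ternaryInit (k η : ℝ) (ζ : ℝ) : ℝ :=
  if η ≤ ζ then -k else if ζ ≤ -η then k else 0

/-- The value `u(t⁺)` of the ternary control, given `u = u(t) ∈ {-k, 0, k}` and `ζ = ζ(t)`. -/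
noncomputable def ternaryNext (k η : ℝ) (u ζ : ℝ) : ℝ :=
  if (u = 0 ∧ η ≤ ζ) ∨ (u = -k ∧ η / 2 < ζ) then -k
  else if (u = 0 ∧ ζ ≤ -η) ∨ (u = k ∧ ζ < -(η / 2)) then k
  else 0

/-! ### Trajectories -/

section Trajectories

variable {E : Type*} [NormedAddCommGroup E] [NormedSpace ℝ E]

/-- The Krasowskii regularization `K(G)(x) = ⋂_{ρ > 0} closure (conv G(B_ρ(x)))`. -/
def krasowskii (G : E → E) (x : E) : Set E :=
  ⋂ ρ > (0 : ℝ), closure (convexHull ℝ (G '' Metric.ball x ρ))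

/-- `φ` is a Krasowskii solution of `ẋ = G(x)` on `[0, τ)`, where `τ ≤ ∞`. -/
structure IsKrasowskiiSolution (G : E → E) (τ : EReal) (φ : ℝ → E) : Prop where
  absCont : ∀ t : ℝ, 0 ≤ t → (t : EReal) < τ → AbsolutelyContinuousOnInterval φ 0 t
  inclusion : ∀ᵐ t : ℝ, 0 < t → (t : EReal) < τ → ∃ v ∈ krasowskii G (φ t), HasDerivAt φ v t

/-- `φ` is a trajectory on `[0, τ)`, `τ ≤ ∞`, of the switched system `ẋ = g(x, w)`, where the
piecewise constant, left continuous signal `w` starts at `w(0) = w₀(y(φ(0)))` and has at each time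
a right limit `w(t⁺)` that is a successor of `w(t)` for the measurement `y(φ(t))`. -/
structure IsSwitchedTrajectory (g : E → ℝ → E) (y : E → ℝ) (w₀ : ℝ → ℝ)
    (next : ℝ → ℝ → ℝ → Prop) (τ : EReal) (φ : ℝ → E) (w : ℝ → ℝ) : Prop where
  absCont : ∀ t : ℝ, 0 ≤ t → (t : EReal) < τ → AbsolutelyContinuousOnInterval φ 0 t
  ode : ∀ᵐ t : ℝ, 0 < t → (t : EReal) < τ → HasDerivAt φ (g (φ t) (w t)) t
  initial : w 0 = w₀ (y (φ 0))
  left : ∀ t : ℝ, 0 < t → (t : EReal) < τ → ∀ᶠ t' in 𝓝[<] t, w t' = w t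
  right : ∀ t : ℝ, 0 ≤ t → (t : EReal) < τ →
    ∃ w', next (w t) (y (φ t)) w' ∧ ∀ᶠ t' in 𝓝[>] t, w t' = w'

end Trajectories

/-! ### The closed-loop systems -/

section ClosedLoops

variable {m s : ℕ} (f : (Fin m → ℝ) × ℝ → (Fin m → ℝ)) (q b : State m (s + 1) → ℝ) (a : Fin s → ℝ)

/-- `φ` is a trajectory of the closed loop with `u = -Ψ(kζ)`, in the sense of Krasowskii. -/
def IsQuantizedTrajectory (δ u₀ : ℝ) (j : ℕ) (k : ℝ) (τ : EReal) (φ : ℝ → State m (s + 1)) :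
    Prop :=
  IsKrasowskiiSolution (fun p => normalForm f q b p (-quantizer δ u₀ j (k * zeta a p))) τ φ

/-- `φ` is a trajectory of the closed loop with `u = -Ψ_m(kζ)`. -/
def IsHysteresisTrajectory (δ u₀ : ℝ) (j : ℕ) (k : ℝ) (τ : EReal) (φ : ℝ → State m (s + 1)) :
    Prop :=
  ∃ w : ℝ → ℝ, IsSwitchedTrajectory (fun p v => normalForm f q b p (-v)) (fun p => k * zeta a p)
    (quantizer δ u₀ j) (hysteresisNext δ u₀ j) τ φ w

/-- `φ` is a trajectory of the closed loop with the ternary controller. -/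
def IsTernaryTrajectory (k η : ℝ) (τ : EReal) (φ : ℝ → State m (s + 1)) : Prop :=
  ∃ w : ℝ → ℝ, IsSwitchedTrajectory (normalForm f q b) (zeta a)
    (ternaryInit k η) (fun u ζ u' => u' = ternaryNext k η u ζ) τ φ w

end ClosedLoops

/-- All trajectories that start in the cube of side `2R` stay in a common bounded set as long as
they exist, and lie in the cube of side `2ε` at all times `t ≥ T`. -/
def PracticallyStable {m s : ℕ} (trajectory : EReal → (ℝ → State m (s + 1)) → Prop)
    (R ε T : ℝ) : Prop :=
  (∃ M : ℝ, ∀ (τ : EReal) (φ : ℝ → State m (s + 1)), trajectory τ φ → φ 0 ∈ cube R →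
      ∀ t : ℝ, 0 ≤ t → (t : EReal) < τ → φ t ∈ cube M) ∧
    ∀ (τ : EReal) (φ : ℝ → State m (s + 1)), trajectory τ φ → φ 0 ∈ cube R →
      ∀ t : ℝ, T ≤ t → (t : EReal) < τ → φ t ∈ cube ε

/-- The argument `kζ` of the quantizer never leaves the range `|kζ| ≤ u₀ / (1 - δ)`, and not even
its interior, along the trajectories that start in the cube of side `2R`. -/
def StaysInRange {m s : ℕ} (trajectory : EReal → (ℝ → State m (s + 1)) → Prop)
    (a : Fin s → ℝ) (k δ u₀ R : ℝ) : Prop :=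
  ∀ (τ : EReal) (φ : ℝ → State m (s + 1)), trajectory τ φ → φ 0 ∈ cube R →
    ∀ t : ℝ, 0 ≤ t → (t : EReal) < τ → |k * zeta a (φ t)| < u₀ / (1 - δ)

end QuantizedControl

open QuantizedControl

namespace QuantizedControl

/-! ### Scalar comparison lemmas -/

/-! All three feedbacks do one thing: outside a dead zone `|ζ| ≤ η` they push `ζ` back with a
strength `C` that the parameters make as large as desired. `IsPushedTrajectory` records only this,
and the main estimate `exists_gain_pushed` concerns such trajectories alone; quantizers and
switching enter only when the three closed loops are shown to be pushed.

The gain `a` is chosen so that `ζ = (D + κ)ˢ ξ₁`, with `D = d/dt` and `s = r - 1`. The variables `(D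
+ κ)ⁱ ξ₁ / κⁱ` then form a cascade of low-pass filters with input `ζ / κˢ` and output `ξ₁`. For `κ ≥
1` their initial values are bounded by `V = 2ˢ R`, whatever `κ` is, so `ξ₁` does not peak, and it
becomes small soon after `ζ` if `κ` is large (`IsChainOn.abs_filtered_le`).

The `z`-subsystem need not tolerate large inputs for long. An input bounded by `V` moves `z` by at
most `1` up to some time `t₁`; afterwards a small input keeps `z` bounded and brings it near the
origin, by asymptotic stability, continuous dependence and compactness (`exists_bound_with_input`,
`exists_attracted_with_input`). Since `V` does not depend on `κ`, `t₁` can be fixed first and `κ`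
then taken so large that the cascade settles within `t₁ / 2` (`exists_gain_chain`). This is why `a`
depends on `R` but not on `ε`.

Finally `C` must dominate the drift of `ζ`, whose size depends on the bound for the trajectory. `C`
is calibrated on a ball slightly larger than the bound that results from it, and a continuity
argument (`lt_of_forall_le_imp_lt`) shows that the larger ball is never left. -/

/-- If `g` starts below `e` and cannot reach `e` as long as it has not exceeded it, it stays
below `e`. -/
theorem lt_of_forall_le_imp_lt {g : ℝ → ℝ} {a b e : ℝ} (hg : ContinuousOn g (Icc a b))
    (ha : a ≤ b → g a < e)
    (h : ∀ t ∈ Icc a b, (∀ s ∈ Icc a t, g s ≤ e) → g t < e) :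
    ∀ t ∈ Icc a b, g t < e := by
  intro t ht
  have hab : a ≤ b := ht.1.trans ht.2
  have key : Icc a b ⊆ {t | g t ≤ e} := by
    refine IsClosed.Icc_subset_of_forall_mem_nhdsGT_of_Icc_subset ?_ (ha hab).le ?_
    · have := hg.preimage_isClosed_of_isClosed isClosed_Icc (isClosed_Iic (a := e))
      rwa [inter_comm] at this
    · intro s hs hsub
      have h1 : g s < e := h s ⟨hs.1, hs.2.le⟩ fun r hr => hsub hr
      have h2 : ∀ᶠ r in 𝓝[Icc a b] s, g r < e :=
        (hg s ⟨hs.1, hs.2.le⟩).eventually (gt_mem_nhds h1)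
      have h3 : 𝓝[>] s ≤ 𝓝[Icc a b] s := by
        rw [← nhdsWithin_Ioc_eq_nhdsGT hs.2]
        exact nhdsWithin_mono _ fun r hr => ⟨hs.1.trans hr.1.le, hr.2⟩
      exact Filter.Eventually.mono (h3 h2) fun r hr => le_of_lt hr
  exact h t ht fun s hs => key ⟨hs.1, hs.2.trans ht.2⟩

/-- `y` decreases at rate at least `c` where it exceeds `η`. -/
def DecreasesAbove (y : ℝ → ℝ) (a b η c : ℝ) : Prop :=
  ∀ s ∈ Icc a b, ∀ t ∈ Icc a b, s ≤ t → (∀ r ∈ Ioc s t, η < y r) → y t ≤ y s - c * (t - s)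

/-- The decrease is integrated from the last time at which `y ≤ η`, or from `a` if there is none. -/
theorem DecreasesAbove.le_max {y : ℝ → ℝ} {a b η c V : ℝ} (hy : ContinuousOn y (Icc a b))
    (hc : 0 ≤ c) (h : DecreasesAbove y a b η c) (ha : y a ≤ V) :
    ∀ t ∈ Icc a b, y t ≤ max η (V - c * (t - a)) := by
  intro t ht
  by_contra! hcon
  obtain ⟨h1, h2⟩ := max_lt_iff.1 hcon
  by_cases hall : ∀ r ∈ Ioc a t, η < y r
  · have := h a ⟨le_rfl, ht.1.trans ht.2⟩ t ht ht.1 hall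
    linarith
  · push Not at hall
    obtain ⟨r, hr, hrη⟩ := hall
    have hcomp : IsCompact (Icc a t ∩ y ⁻¹' Iic η) := by
      refine isCompact_Icc.of_isClosed_subset ?_ inter_subset_left
      exact (hy.mono (Icc_subset_Icc_right ht.2)).preimage_isClosed_of_isClosed isClosed_Icc
        isClosed_Iic
    obtain ⟨s, ⟨hs, hsη⟩, hmax⟩ := hcomp.exists_isGreatest ⟨r, ⟨hr.1.le, hr.2⟩, hrη⟩
    have hsη' : y s ≤ η := hsη
    have := h s ⟨hs.1, hs.2.trans ht.2⟩ t ht hs.2 fun r hr => by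
      by_contra! hle
      exact absurd (hmax ⟨⟨hs.1.trans hr.1.le, hr.2⟩, hle⟩) (not_le.2 hr.1)
    have h3 : 0 ≤ c * (t - s) := mul_nonneg hc (sub_nonneg.2 hs.2)
    linarith

theorem abs_le_max_of_decreasesAbove {y : ℝ → ℝ} {a b η c V : ℝ} (hy : ContinuousOn y (Icc a b))
    (hc : 0 ≤ c) (h : DecreasesAbove y a b η c) (h' : DecreasesAbove (fun t => -y t) a b η c)
    (ha : |y a| ≤ V) : ∀ t ∈ Icc a b, |y t| ≤ max η (V - c * (t - a)) := by
  intro t ht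
  rw [abs_le'] at ha ⊢
  exact ⟨h.le_max hy hc ha.1 t ht, h'.le_max hy.neg hc ha.2 t ht⟩

theorem decreasesAbove_of_hasDerivWithinAt {y y' : ℝ → ℝ} {a b η c : ℝ}
    (hy : ContinuousOn y (Icc a b)) (hd : ∀ t ∈ Ico a b, HasDerivWithinAt y (y' t) (Ici t) t)
    (h : ∀ t ∈ Ico a b, η ≤ y t → y' t ≤ -c) : DecreasesAbove y a b η c := by
  intro s hs t ht hst hall
  have hsub : Icc s t ⊆ Icc a b := Icc_subset_Icc hs.1 ht.2
  rcases hst.eq_or_lt with rfl | hlt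
  · simp
  -- Only `r > s` is known to satisfy `η < y r`; continuity gives the weak inequality at `s`, which
  -- is why the derivative hypothesis covers `η ≤ y t`.
  have hsη : η ≤ y s := by
    have hcont : Tendsto y (𝓝[Ioc s t] s) (𝓝 (y s)) :=
      ((hy s hs).mono (Ioc_subset_Icc_self.trans hsub))
    have : (𝓝[Ioc s t] s).NeBot := by
      rw [nhdsWithin_Ioc_eq_nhdsGT hlt]; infer_instance
    exact ge_of_tendsto hcont (eventually_mem_nhdsWithin.mono fun r hr => (hall r hr).le)
  have := image_le_of_deriv_right_le_deriv_boundary (f := y) (f' := y') (a := s) (b := t)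
    (B := fun r => y s - c * (r - s)) (B' := fun _ => -c) (hy.mono hsub)
    (fun r hr => hd r ⟨hs.1.trans hr.1, hr.2.trans_le ht.2⟩) (by simp) (by fun_prop)
    (fun r _ => by
      have : HasDerivAt (fun r => y s - c * (r - s)) (-c) r := by
        simpa using (((hasDerivAt_id r).sub_const s).const_mul c).const_sub (y s)
      exact this.hasDerivWithinAt)
    (fun r hr => h r ⟨hs.1.trans hr.1, hr.2.trans_le ht.2⟩ (by
      rcases hr.1.eq_or_lt with rfl | h2
      · exact hsη
      · exact (hall r ⟨h2, hr.2.le⟩).le))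
  exact this ⟨hst, le_rfl⟩

/-- The integral form of the decrease lets almost-everywhere information suffice: an absolutely
continuous function is the integral of its derivative. -/
theorem decreasesAbove_of_absolutelyContinuous {y : ℝ → ℝ} {a b η c : ℝ}
    (hy : AbsolutelyContinuousOnInterval y a b)
    (h : ∀ᵐ t : ℝ, t ∈ Ioo a b → ∃ p, HasDerivAt y p t ∧ (η < y t → p ≤ -c)) :
    DecreasesAbove y a b η c := by
  intro s hs t ht hst hall
  have hsub : uIcc s t ⊆ uIcc a b := by
    rw [uIcc_of_le hst, uIcc_of_le (hs.1.trans hs.2)]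
    exact Icc_subset_Icc hs.1 ht.2
  have hac := hy.mono hsub
  have h1 := hac.integral_deriv_eq_sub
  have h2 : ∫ r in s..t, deriv y r ≤ ∫ _ in s..t, -c := by
    refine intervalIntegral.integral_mono_ae_restrict hst hac.intervalIntegrable_deriv
      intervalIntegrable_const ?_
    have hne : ∀ᵐ r : ℝ, r ≠ t := by simp [ae_iff, measure_singleton]
    have hne' : ∀ᵐ r : ℝ, r ≠ s := by simp [ae_iff, measure_singleton]
    rw [EventuallyLE, ae_restrict_iff' measurableSet_Icc]
    filter_upwards [h, hne, hne'] with r hr hrt hrs hmem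
    have hlt : r < t := lt_of_le_of_ne hmem.2 hrt
    have hgt : s < r := lt_of_le_of_ne hmem.1 (Ne.symm hrs)
    obtain ⟨p, hp, hpc⟩ := hr ⟨hs.1.trans_lt hgt, hlt.trans_le ht.2⟩
    rw [hp.deriv]
    exact hpc (hall r ⟨hgt, hlt.le⟩)
  rw [h1] at h2
  simp only [intervalIntegral.integral_const, smul_eq_mul] at h2
  linarith

/-- An absolutely continuous function whose derivative agrees almost everywhere with a continuous
function is differentiable from the right. -/
theorem hasDerivWithinAt_Ici_of_ae {E : Type*} [NormedAddCommGroup E] [NormedSpace ℝ E]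
    [CompleteSpace E] {y h : ℝ → E} {b : ℝ} (hy : AbsolutelyContinuousOnInterval y 0 b)
    (hh : ContinuousOn h (Icc 0 b)) (hd : ∀ᵐ t : ℝ, t ∈ Ioo 0 b → HasDerivAt y (h t) t) :
    ∀ t ∈ Ico 0 b, HasDerivWithinAt y (h t) (Ici t) t := by
  intro t ht
  have hb : 0 ≤ b := ht.1.trans ht.2.le
  -- The constant extension `H` of `h` is continuous on the line, so its primitive `G` is C¹, and `y
  -- - G` is absolutely continuous with derivative zero almost everywhere.
  set H : ℝ → E := IccExtend hb ((Icc 0 b).domRestrict h) with hH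
  have hHc : Continuous H := (continuousOn_iff_continuous_domRestrict.1 hh).Icc_extend'
  have hHh : ∀ r ∈ Icc 0 b, H r = h r := fun r hr => by
    rw [hH, IccExtend_of_mem _ _ hr]; rfl
  set G : ℝ → E := fun r => ∫ x in (0 : ℝ)..r, H x with hG
  have hGd : ∀ r, HasDerivAt G (H r) r := fun r =>
    intervalIntegral.integral_hasDerivAt_right (hHc.intervalIntegrable _ _)
      (hHc.stronglyMeasurableAtFilter _ _) hHc.continuousAt
  have hGac : AbsolutelyContinuousOnInterval G 0 b := by
    have : ContDiff ℝ 1 G := by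
      rw [contDiff_one_iff_deriv]
      refine ⟨fun r => (hGd r).differentiableAt, ?_⟩
      have : deriv G = H := funext fun r => (hGd r).deriv
      rwa [this]
    exact this.contDiffOn.absolutelyContinuousOnInterval
  have hne : ∀ᵐ r : ℝ, r ≠ 0 := by simp [ae_iff, measure_singleton]
  have hne' : ∀ᵐ r : ℝ, r ≠ b := by simp [ae_iff, measure_singleton]
  obtain ⟨C, hC⟩ := (hy.sub hGac).const_of_ae_hasDerivAt_zero (by
    filter_upwards [hd, hne, hne'] with r hr h0 h1 hmem
    rw [uIcc_of_le hb] at hmem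
    have hr' := hr ⟨lt_of_le_of_ne hmem.1 (Ne.symm h0), lt_of_le_of_ne hmem.2 h1⟩
    have := hr'.sub (hGd r)
    rwa [hHh r hmem, sub_self] at this)
  rw [uIcc_of_le hb] at hC
  have hyG : ∀ r ∈ Icc 0 b, y r = C + G r := fun r hr => by
    have := hC r hr
    simp only [Pi.sub_apply] at this
    rw [← this, sub_add_cancel]
  have h1 : HasDerivWithinAt (fun r => C + G r) (h t) (Ici t) t := by
    rw [← hHh t ⟨ht.1, ht.2.le⟩]
    exact ((hGd t).const_add C).hasDerivWithinAt
  refine h1.congr_of_eventuallyEq ?_ (hyG t ⟨ht.1, ht.2.le⟩)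
  have : Icc t b ∈ 𝓝[≥] t := Icc_mem_nhdsGE ht.2
  filter_upwards [this] with r hr
  exact hyG r ⟨ht.1.trans hr.1, hr.2⟩

end QuantizedControl

namespace QuantizedControl

/-! ### Asymptotically stable systems with a small input -/

section Driven

variable {E : Type*} [NormedAddCommGroup E] [NormedSpace ℝ E]

/-- `z` solves `ż = f(z, y(t))` on `[0, b]`. -/
structure IsDrivenOn (f : E × ℝ → E) (z : ℝ → E) (y : ℝ → ℝ) (b : ℝ) : Prop where
  cont : ContinuousOn z (Icc 0 b)
  deriv : ∀ t ∈ Ico 0 b, HasDerivWithinAt z (f (z t, y t)) (Ici t) t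

theorem IsDrivenOn.mono {f : E × ℝ → E} {z : ℝ → E} {y : ℝ → ℝ} {b b' : ℝ}
    (h : IsDrivenOn f z y b) (hb : b' ≤ b) : IsDrivenOn f z y b' :=
  ⟨h.cont.mono (Icc_subset_Icc_right hb), fun t ht => h.deriv t ⟨ht.1, ht.2.trans_le hb⟩⟩

theorem IsDrivenOn.shift {f : E × ℝ → E} {z : ℝ → E} {y : ℝ → ℝ} {b t₀ : ℝ}
    (h : IsDrivenOn f z y b) (ht₀ : 0 ≤ t₀) :
    IsDrivenOn f (fun t => z (t + t₀)) (fun t => y (t + t₀)) (b - t₀) := by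
  refine ⟨h.cont.comp (by fun_prop) fun t ht => ⟨by linarith [ht.1], by linarith [ht.2]⟩,
    fun t ht => ?_⟩
  have h1 := h.deriv (t + t₀) ⟨by linarith [ht.1], by linarith [ht.2]⟩
  have h2 : HasDerivWithinAt (fun r : ℝ => r + t₀) 1 (Ici t) t :=
    ((hasDerivAt_id t).add_const t₀).hasDerivWithinAt
  have h3 := h1.scomp t h2 fun r hr => add_le_add_left (mem_Ici.1 hr) t₀
  simpa [Function.comp_def] using h3

theorem IsForwardSolution.continuousOn {F : E → E} {x : ℝ → E} (h : IsForwardSolution F x) :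
    ContinuousOn x (Ici 0) :=
  fun t ht => (h t ht).continuousWithinAt

theorem IsForwardSolution.hasDerivWithinAt_Ici {F : E → E} {x : ℝ → E}
    (h : IsForwardSolution F x) {t : ℝ} (ht : 0 ≤ t) : HasDerivWithinAt x (F (x t)) (Ici t) t :=
  (h t ht).mono (Ici_subset_Ici.2 ht)

theorem exists_lipschitzOnWith_of_isCompact {X Y : Type*} [PseudoMetricSpace X]
    [PseudoMetricSpace Y] {f : X → Y} (hf : LocallyLipschitz f) {S : Set X} (hS : IsCompact S) :
    ∃ K, LipschitzOnWith K f S :=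
  LocallyLipschitzOn.exists_lipschitzOnWith_of_compact hS hf.locallyLipschitzOn

variable [ProperSpace E]

theorem exists_norm_le_of_isCompact {X Y : Type*} [TopologicalSpace X]
    [SeminormedAddCommGroup Y] {f : X → Y} (hf : Continuous f) {S : Set X} (hS : IsCompact S) :
    ∃ B, 0 < B ∧ ∀ x ∈ S, ‖f x‖ ≤ B := by
  obtain ⟨B, hB⟩ := hS.exists_bound_of_continuousOn hf.continuousOn
  exact ⟨max B 1, by positivity, fun x hx => (hB x hx).trans (le_max_left _ _)⟩

/-- Over a short time the state changes little, uniformly for bounded inputs. -/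
theorem exists_short_time_bound {f : E × ℝ → E} (hf : LocallyLipschitz f) (ρ Y : ℝ) :
    ∃ t₁ > 0, ∀ (z : ℝ → E) (y : ℝ → ℝ) (b : ℝ), IsDrivenOn f z y b → ‖z 0‖ ≤ ρ →
      (∀ t ∈ Icc 0 b, |y t| ≤ Y) → ∀ t ∈ Icc 0 b, t ≤ t₁ → ‖z t‖ ≤ ρ + 1 := by
  obtain ⟨B, hB0, hB⟩ := exists_norm_le_of_isCompact hf.continuous
    ((isCompact_closedBall (0 : E) (ρ + 1)).prod (isCompact_Icc (a := -Y) (b := Y)))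
  -- With speed at most `B` in the ball of radius `ρ + 1`, the displacement up to this time is at
  -- most `1 / 2`, strictly less than the margin `1`.
  refine ⟨1 / (2 * B), by positivity, fun z y b hz h0 hy t ht htt => ?_⟩
  have hz' := hz.mono (min_le_left b (1 / (2 * B)))
  have := lt_of_forall_le_imp_lt (g := fun t => ‖z t‖) (e := ρ + 1) hz'.cont.norm
    (fun _ => by linarith) (fun s hs hle => ?_) t ⟨ht.1, le_min ht.2 htt⟩
  · exact this.le
  · have h1 := norm_image_sub_le_of_norm_deriv_right_le_segment
      (hz'.cont.mono (Icc_subset_Icc_right hs.2))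
      (fun r hr => hz'.deriv r ⟨hr.1, hr.2.trans_le hs.2⟩) (C := B)
      (fun r hr => hB _ ⟨by simpa using hle r ⟨hr.1, hr.2.le⟩, abs_le.1 (hy r ⟨hr.1,
        hr.2.le.trans (hs.2.trans (min_le_left _ _))⟩)⟩) s ⟨hs.1, le_rfl⟩
    have h2 : B * (s - 0) ≤ B * (1 / (2 * B)) :=
      mul_le_mul_of_nonneg_left (by simpa using hs.2.trans (min_le_right _ _)) hB0.le
    have h3 : B * (1 / (2 * B)) = 1 / 2 := by field_simp
    have h4 : ‖z s‖ ≤ ‖z 0‖ + ‖z s - z 0‖ := by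
      simpa using norm_add_le (z 0) (z s - z 0)
    linarith

/-- Continuous dependence on the initial value and on a small input. -/
theorem exists_close_to_solution {f : E × ℝ → E} (hf : LocallyLipschitz f) {x : ℝ → E}
    (hx : IsForwardSolution (fun z => f (z, 0)) x) {T e : ℝ} (he : 0 < e) :
    ∃ r > 0, ∀ (z : ℝ → E) (y : ℝ → ℝ) (b : ℝ), IsDrivenOn f z y b → ‖z 0 - x 0‖ ≤ r →
      (∀ t ∈ Icc 0 b, |y t| ≤ r) → ∀ t ∈ Icc 0 b, t ≤ T → ‖z t - x t‖ ≤ e := by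
  have hxc : ContinuousOn x (Icc 0 T) := hx.continuousOn.mono Icc_subset_Ici_self
  obtain ⟨M, hM⟩ := isCompact_Icc.exists_bound_of_continuousOn hxc
  obtain ⟨K', hK'⟩ := exists_lipschitzOnWith_of_isCompact hf
    ((isCompact_closedBall (0 : E) (M + e)).prod (isCompact_Icc (a := (-1 : ℝ)) (b := 1)))
  -- The added `1` makes `K` positive, as the closed form of the Gronwall bound requires.
  set K : NNReal := K' + 1
  have hK : LipschitzOnWith K f _ := hK'.weaken (le_add_of_nonneg_right zero_le_one)
  have hK0 : (K : ℝ) ≠ 0 := by positivity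
  have hKp : (0 : ℝ) < K := by positivity
  set X := Real.exp (K * T)
  have hX : 0 < X := Real.exp_pos _
  -- An initial error `r` and a velocity error `K * r` give the Gronwall bound `r X + r (X - 1) < 2
  -- e / 3`.
  set r := min 1 (e / (3 * X))
  have hr : 0 < r := by positivity
  have hrX : r * X ≤ e / 3 := by
    calc r * X ≤ e / (3 * X) * X := by gcongr; exact min_le_right _ _
      _ = e / 3 := by field_simp
  refine ⟨r, hr, fun z y b hz h0 hy t ht htT => ?_⟩
  have hb1 : min b T ≤ b := min_le_left _ _
  have hb2 : min b T ≤ T := min_le_right _ _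
  have h0e : r < e ∨ T < 0 := by
    by_cases hT : T < 0
    · exact Or.inr hT
    · left
      have : 1 ≤ X := Real.one_le_exp (by push Not at hT; positivity)
      nlinarith
  have hT : ¬ T < 0 := fun h => absurd (ht.1.trans htT) (not_le.2 h)
  have hre : r < e := h0e.resolve_right hT
  have hcont : ContinuousOn (fun t => ‖z t - x t‖) (Icc 0 (min b T)) :=
    ((hz.cont.mono (Icc_subset_Icc_right hb1)).sub (hxc.mono (Icc_subset_Icc_right hb2))).norm
  refine (lt_of_forall_le_imp_lt hcont (fun _ => h0.trans_lt hre) (fun s hs hle => ?_) t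
    ⟨ht.1, le_min ht.2 htT⟩).le
  have hmemx : ∀ q ∈ Ico 0 s, x q ∈ Metric.closedBall (0 : E) (M + e) := fun q hq => by
    have := hM q ⟨hq.1, hq.2.le.trans (hs.2.trans hb2)⟩
    rw [mem_closedBall_zero_iff]; linarith
  have hmemz : ∀ q ∈ Ico 0 s, z q ∈ Metric.closedBall (0 : E) (M + e) := fun q hq => by
    have h1 := hM q ⟨hq.1, hq.2.le.trans (hs.2.trans hb2)⟩
    have h2 := hle q ⟨hq.1, hq.2.le⟩
    have h3 : ‖z q‖ ≤ ‖x q‖ + ‖z q - x q‖ := by simpa using norm_add_le (x q) (z q - x q)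
    rw [mem_closedBall_zero_iff]; linarith
  have h01 : (0 : ℝ) ∈ Icc (-1 : ℝ) 1 := by norm_num
  have hgr := dist_le_of_approx_trajectories_ODE_of_mem (v := fun _ w => f (w, 0)) (K := K)
    (s := fun _ => Metric.closedBall (0 : E) (M + e)) (f := z) (g := x) (a := 0) (b := s)
    (f' := fun q => f (z q, y q)) (g' := fun q => f (x q, 0)) (εf := K * r) (εg := 0) (δ := r)
    (fun q _ => by
      refine LipschitzOnWith.of_dist_le_mul fun p hp p' hp' => ?_
      have := hK.dist_le_mul (p, 0) ⟨hp, h01⟩ (p', 0) ⟨hp', h01⟩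
      simpa [Prod.dist_eq] using this)
    (hz.cont.mono (Icc_subset_Icc_right (hs.2.trans hb1)))
    (fun q hq => hz.deriv q ⟨hq.1, hq.2.trans_le (hs.2.trans hb1)⟩)
    (fun q hq => by
      have hyq := hy q ⟨hq.1, hq.2.le.trans (hs.2.trans hb1)⟩
      have hyq1 : |y q| ≤ 1 := hyq.trans (min_le_left _ _)
      have := hK.dist_le_mul (z q, y q) ⟨hmemz q hq, abs_le.1 hyq1⟩ (z q, 0) ⟨hmemz q hq, h01⟩
      refine this.trans ?_
      rw [Prod.dist_eq]
      simp only [dist_self, Real.dist_eq, sub_zero]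
      rw [max_eq_right (abs_nonneg _)]
      gcongr)
    hmemz (hxc.mono (Icc_subset_Icc_right (hs.2.trans hb2)))
    (fun q hq => hx.hasDerivWithinAt_Ici hq.1) (fun q _ => by simp) hmemx
    (by rwa [dist_eq_norm]) s ⟨hs.1, le_rfl⟩
  rw [dist_eq_norm, gronwallBound_of_K_ne_0 hK0] at hgr
  have hXs : Real.exp (K * (s - 0)) ≤ X := by
    apply Real.exp_le_exp.2
    rw [sub_zero]
    exact mul_le_mul_of_nonneg_left (hs.2.trans hb2) hKp.le
  have h5 : (K * r + 0) / (K : ℝ) = r := by field_simp; ring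
  rw [h5] at hgr
  nlinarith [mul_le_mul_of_nonneg_left hXs hr.le]

/-- Uniformly on bounded sets, solutions with a small input follow up to some bounded time a
solution without input that has come close to the origin at that time. -/
theorem exists_horizon {f : E × ℝ → E} (hf : LocallyLipschitz f)
    (hatt : AttractedFrom (fun z => f (z, 0)) univ) (ρ : ℝ) {δ e : ℝ} (hδ : 0 < δ) (he : 0 < e) :
    ∃ η > 0, ∃ Tm M : ℝ, ∀ (z : ℝ → E) (y : ℝ → ℝ) (b : ℝ), IsDrivenOn f z y b → ‖z 0‖ ≤ ρ →
      (∀ t ∈ Icc 0 b, |y t| ≤ η) → ∃ T' x, 1 ≤ T' ∧ T' ≤ Tm ∧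
        IsForwardSolution (fun z => f (z, 0)) x ∧ ‖x 0‖ ≤ ρ ∧ ‖x T'‖ ≤ δ ∧
        ∀ t ∈ Icc 0 b, t ≤ T' → ‖z t - x t‖ ≤ e ∧ ‖z t‖ ≤ M := by
  suffices h : ∃ η > 0, ∃ Tm M : ℝ, ∀ (z : ℝ → E) (y : ℝ → ℝ) (b : ℝ), IsDrivenOn f z y b →
      z 0 ∈ Metric.closedBall (0 : E) ρ →
      (∀ t ∈ Icc 0 b, |y t| ≤ η) → ∃ T' x, 1 ≤ T' ∧ T' ≤ Tm ∧
        IsForwardSolution (fun z => f (z, 0)) x ∧ ‖x 0‖ ≤ ρ ∧ ‖x T'‖ ≤ δ ∧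
        ∀ t ∈ Icc 0 b, t ≤ T' → ‖z t - x t‖ ≤ e ∧ ‖z t‖ ≤ M by
    simpa only [mem_closedBall_zero_iff] using h
  -- Compactness induction: the property passes to subsets and finite unions, and near each point
  -- `x₀` of the ball it holds with one comparison solution started at `x₀` itself.
  refine (isCompact_closedBall (0 : E) ρ).induction_on
    (p := fun S => ∃ η > 0, ∃ Tm M : ℝ, ∀ (z : ℝ → E) (y : ℝ → ℝ) (b : ℝ), IsDrivenOn f z y b →
      z 0 ∈ S →
      (∀ t ∈ Icc 0 b, |y t| ≤ η) → ∃ T' x, 1 ≤ T' ∧ T' ≤ Tm ∧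
        IsForwardSolution (fun z => f (z, 0)) x ∧ ‖x 0‖ ≤ ρ ∧ ‖x T'‖ ≤ δ ∧
        ∀ t ∈ Icc 0 b, t ≤ T' → ‖z t - x t‖ ≤ e ∧ ‖z t‖ ≤ M) ?_ ?_ ?_ ?_
  · exact ⟨1, one_pos, 0, 0, fun z y b _ h => absurd h (notMem_empty _)⟩
  · rintro S S' hSS ⟨η, hη, Tm, M, h⟩
    exact ⟨η, hη, Tm, M, fun z y b hz h0 => h z y b hz (hSS h0)⟩
  · rintro S S' ⟨η, hη, Tm, M, h⟩ ⟨η', hη', Tm', M', h'⟩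
    refine ⟨min η η', lt_min hη hη', max Tm Tm', max M M', fun z y b hz h0 hy => ?_⟩
    rcases h0 with h0 | h0
    · obtain ⟨T', x, h1, h2, h3, h4, h5, h6⟩ := h z y b hz h0 fun t ht =>
        (hy t ht).trans (min_le_left _ _)
      exact ⟨T', x, h1, h2.trans (le_max_left _ _), h3, h4, h5, fun t ht htT =>
        ⟨(h6 t ht htT).1, (h6 t ht htT).2.trans (le_max_left _ _)⟩⟩
    · obtain ⟨T', x, h1, h2, h3, h4, h5, h6⟩ := h' z y b hz h0 fun t ht =>
        (hy t ht).trans (min_le_right _ _)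
      exact ⟨T', x, h1, h2.trans (le_max_right _ _), h3, h4, h5, fun t ht htT =>
        ⟨(h6 t ht htT).1, (h6 t ht htT).2.trans (le_max_right _ _)⟩⟩
  · intro x₀ hx₀
    obtain ⟨x, hx, hx0⟩ := hatt.1 x₀ (mem_univ _)
    have hlim := hatt.2 x hx (mem_univ _)
    have hev : ∀ᶠ t in atTop, ‖x t‖ < δ := by
      have := hlim.norm
      rw [norm_zero] at this
      exact this.eventually (gt_mem_nhds hδ)
    obtain ⟨T', hT', hT1⟩ := (hev.and (eventually_ge_atTop 1)).exists
    obtain ⟨r, hr, hclose⟩ := exists_close_to_solution hf hx (T := T') he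
    obtain ⟨M, hM⟩ := isCompact_Icc.exists_bound_of_continuousOn
      (hx.continuousOn.mono (Icc_subset_Ici_self : Icc 0 T' ⊆ Ici 0))
    refine ⟨Metric.closedBall x₀ r, mem_nhdsWithin_of_mem_nhds (Metric.closedBall_mem_nhds _ hr),
      r, hr, T', M + e, fun z y b hz h0 hy => ⟨T', x, hT1, le_rfl, hx, ?_, hT'.le, ?_⟩⟩
    · rw [hx0]; simpa using hx₀
    · intro t ht htT
      have h1 := hclose z y b hz (by rw [hx0]; simpa [dist_eq_norm] using h0) hy t ht htT
      have h2 := hM t ⟨ht.1, htT⟩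
      have h3 : ‖z t‖ ≤ ‖x t‖ + ‖z t - x t‖ := by simpa using norm_add_le (x t) (z t - x t)
      exact ⟨h1, by linarith⟩

/-- Stability of the origin under small inputs. -/
theorem exists_stable_with_input {f : E × ℝ → E} (hf : LocallyLipschitz f)
    (hs : IsGloballyAsymptoticallyStable fun z => f (z, 0)) {ε : ℝ} (hε : 0 < ε) :
    ∃ δ > 0, ∃ η > 0, ∀ (z : ℝ → E) (y : ℝ → ℝ) (b : ℝ), IsDrivenOn f z y b → ‖z 0‖ ≤ δ →
      (∀ t ∈ Icc 0 b, |y t| ≤ η) → ∀ t ∈ Icc 0 b, ‖z t‖ ≤ ε := by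
  obtain ⟨δ₀, hδ₀, hst⟩ := hs.stable (ε / 2) (by positivity)
  -- At the end of the horizon the state is within `δ₀ / 4 + δ₀ / 4` of the origin, back in the
  -- initial ball; until then it is within `ε / 2 + ε / 2`. Hence the argument can be restarted.
  obtain ⟨η, hη, Tm, M, hH⟩ := exists_horizon hf hs.attractive (δ₀ / 2) (δ := δ₀ / 4)
    (e := min (ε / 2) (δ₀ / 4)) (by positivity) (by positivity)
  refine ⟨δ₀ / 2, by positivity, η, hη, ?_⟩
  -- Every restart uses up at least one unit of time, since `1 ≤ T'`, so finitely many restarts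
  -- reach any `t`.
  have key : ∀ n : ℕ, ∀ (z : ℝ → E) (y : ℝ → ℝ) (b : ℝ), IsDrivenOn f z y b → ‖z 0‖ ≤ δ₀ / 2 →
      (∀ t ∈ Icc 0 b, |y t| ≤ η) → ∀ t ∈ Icc 0 b, t ≤ n → ‖z t‖ ≤ ε := by
    intro n
    induction n with
    | zero =>
      intro z y b hz h0 hy t ht htn
      obtain ⟨T', x, hT1, -, hx, hx0, -, hcl⟩ := hH z y b hz h0 hy
      have h1 := (hcl t ht (by push_cast at htn; linarith)).1.trans (min_le_left _ _)
      have h2 := hst x hx (by linarith) t ht.1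
      have h3 : ‖z t‖ ≤ ‖x t‖ + ‖z t - x t‖ := by simpa using norm_add_le (x t) (z t - x t)
      linarith
    | succ n ih =>
      intro z y b hz h0 hy t ht htn
      obtain ⟨T', x, hT1, -, hx, hx0, hxT, hcl⟩ := hH z y b hz h0 hy
      by_cases htT : t ≤ T'
      · have h1 := (hcl t ht htT).1.trans (min_le_left _ _)
        have h2 := hst x hx (by linarith) t ht.1
        have h3 : ‖z t‖ ≤ ‖x t‖ + ‖z t - x t‖ := by simpa using norm_add_le (x t) (z t - x t)
        linarith
      · push Not at htT
        have hT0 : 0 ≤ T' := by linarith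
        have hTb : T' ∈ Icc 0 b := ⟨hT0, htT.le.trans ht.2⟩
        have h1 := (hcl T' hTb le_rfl).1.trans (min_le_right _ _)
        have h3 : ‖z T'‖ ≤ ‖x T'‖ + ‖z T' - x T'‖ := by
          simpa using norm_add_le (x T') (z T' - x T')
        have := ih _ _ _ (hz.shift hT0) (by simp only [zero_add]; linarith)
          (fun r hr => hy (r + T') ⟨by linarith [hr.1], by linarith [hr.2]⟩) (t - T')
          ⟨by linarith, by linarith [ht.2]⟩ (by push_cast at htn; linarith)
        simpa using this
  intro z y b hz h0 hy t ht
  obtain ⟨n, hn⟩ := exists_nat_ge t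
  exact key n z y b hz h0 hy t ht hn

/-- Uniform practical attraction under small inputs. -/
theorem exists_attracted_with_input {f : E × ℝ → E} (hf : LocallyLipschitz f)
    (hs : IsGloballyAsymptoticallyStable fun z => f (z, 0)) (ρ : ℝ) {ε : ℝ} (hε : 0 < ε) :
    ∃ η > 0, ∃ T > 0, ∃ M : ℝ, ∀ (z : ℝ → E) (y : ℝ → ℝ) (b : ℝ), IsDrivenOn f z y b →
      ‖z 0‖ ≤ ρ → (∀ t ∈ Icc 0 b, |y t| ≤ η) →
      ∀ t ∈ Icc 0 b, ‖z t‖ ≤ M ∧ (T ≤ t → ‖z t‖ ≤ ε) := by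
  obtain ⟨δ, hδ, η₁, hη₁, hS⟩ := exists_stable_with_input hf hs hε
  obtain ⟨η₂, hη₂, Tm, M, hH⟩ := exists_horizon hf hs.attractive ρ (δ := δ / 2) (e := δ / 2)
    (by positivity) (by positivity)
  refine ⟨min η₁ η₂, lt_min hη₁ hη₂, max Tm 1, by positivity, max M ε,
    fun z y b hz h0 hy t ht => ?_⟩
  obtain ⟨T', x, hT1, hTm, hx, hx0, hxT, hcl⟩ := hH z y b hz h0 fun t ht =>
    (hy t ht).trans (min_le_right _ _)
  have hlate : T' ≤ t → ‖z t‖ ≤ ε := by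
    intro htT
    have hT0 : 0 ≤ T' := by linarith
    have hTb : T' ∈ Icc 0 b := ⟨hT0, htT.trans ht.2⟩
    have h1 := (hcl T' hTb le_rfl).1
    have h3 : ‖z T'‖ ≤ ‖x T'‖ + ‖z T' - x T'‖ := by
      simpa using norm_add_le (x T') (z T' - x T')
    have := hS _ _ _ (hz.shift hT0) (by simp only [zero_add]; linarith)
      (fun r hr => (hy (r + T') ⟨by linarith [hr.1], by linarith [hr.2]⟩).trans
        (min_le_left _ _)) (t - T') ⟨by linarith, by linarith [ht.2]⟩
    simpa using this
  constructor
  · rcases le_total t T' with h | h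
    · exact (hcl t ht h).2.trans (le_max_left _ _)
    · exact (hlate h).trans (le_max_right _ _)
  · exact fun h => hlate (hTm.trans ((le_max_left _ _).trans h))

/-- Bounded inputs that become small soon enough keep the state bounded. -/
theorem exists_bound_with_input {f : E × ℝ → E} (hf : LocallyLipschitz f)
    (hs : IsGloballyAsymptoticallyStable fun z => f (z, 0)) (ρ Y : ℝ) :
    ∃ η > 0, ∃ t₁ > 0, ∃ M : ℝ, ∀ (z : ℝ → E) (y : ℝ → ℝ) (b : ℝ), IsDrivenOn f z y b →
      ‖z 0‖ ≤ ρ → (∀ t ∈ Icc 0 b, |y t| ≤ Y) → (∀ t ∈ Icc 0 b, t₁ ≤ t → |y t| ≤ η) →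
      ∀ t ∈ Icc 0 b, ‖z t‖ ≤ M := by
  obtain ⟨t₁, ht₁, hshort⟩ := exists_short_time_bound hf ρ Y
  -- The smallness of the later input is calibrated to `ρ + 1`, the radius that may have been
  -- reached at time `t₁`.
  obtain ⟨η, hη, T, hT, M, hM⟩ := exists_attracted_with_input hf hs (ρ + 1) one_pos
  refine ⟨η, hη, t₁, ht₁, max (ρ + 1) M, fun z y b hz h0 hy hy' t ht => ?_⟩
  rcases le_total t t₁ with h | h
  · exact (hshort z y b hz h0 hy t ht h).trans (le_max_left _ _)
  · have := hM _ _ _ (hz.shift ht₁.le)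
      (by simpa using hshort z y b hz h0 hy t₁ ⟨ht₁.le, h.trans ht.2⟩ le_rfl)
      (fun r hr => hy' (r + t₁) ⟨by linarith [hr.1], by linarith [hr.2]⟩ (by linarith [hr.1]))
      (t - t₁) ⟨by linarith, by linarith [ht.2]⟩
    exact (by simpa using this.1 : ‖z t‖ ≤ M).trans (le_max_right _ _)

end Driven

end QuantizedControl

namespace QuantizedControl

/-! ### Chains of integrators and high-gain filters -/

/-- The operator `(σ + κ)ⁱ`, where `σ` is the shift of sequences. -/
def shiftFilter (κ : ℝ) : ℕ → (ℕ → ℝ) → ℕ → ℝ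
  | 0, x, l => x l
  | i + 1, x, l => shiftFilter κ i x (l + 1) + κ * shiftFilter κ i x l

/-- `(σ + κ)ⁱ` is a monic polynomial in `σ`; its lower coefficients supply the feedback row. -/
theorem exists_shiftFilter_eq_sum (κ : ℝ) (i : ℕ) : ∃ a : ℕ → ℝ, ∀ x l,
    shiftFilter κ i x l = ∑ m ∈ Finset.range i, a m * x (l + m) + x (l + i) := by
  induction i with
  | zero => exact ⟨0, fun x l => by simp [shiftFilter]⟩
  | succ i ih =>
    obtain ⟨a, ha⟩ := ih
    refine ⟨fun m => (if m = 0 then 0 else a (m - 1)) + κ * (if m < i then a m else 1),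
      fun x l => ?_⟩
    simp only [shiftFilter, ha, add_mul, Finset.sum_add_distrib]
    rw [Finset.sum_range_succ' (fun m => (if m = 0 then 0 else a (m - 1)) * x (l + m)),
      Finset.sum_range_succ (fun m => κ * (if m < i then a m else 1) * x (l + m))]
    have h1 : ∑ m ∈ Finset.range i, κ * (if m < i then a m else 1) * x (l + m)
        = κ * ∑ m ∈ Finset.range i, a m * x (l + m) := by
      rw [Finset.mul_sum]
      refine Finset.sum_congr rfl fun m hm => ?_
      rw [if_pos (Finset.mem_range.1 hm)]; ring
    have h2 : ∑ m ∈ Finset.range i, a m * x (l + 1 + m)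
        = ∑ m ∈ Finset.range i, (if m + 1 = 0 then 0 else a (m + 1 - 1)) * x (l + (m + 1)) := by
      refine Finset.sum_congr rfl fun m _ => ?_
      rw [if_neg (Nat.succ_ne_zero m), Nat.add_sub_cancel, add_assoc, add_comm 1 m]
    rw [h1, h2]
    simp only [lt_irrefl, if_false, if_true]
    have h3 : l + 1 + i = l + (i + 1) := by omega
    rw [h3]
    ring

/-- Each factor costs at most `1 + κ ≤ 2 κ`. After division by `κⁱ` a bound `2ⁱ R` remains, free of
`κ`. -/
theorem abs_shiftFilter_le {κ R : ℝ} (hκ : 1 ≤ κ) (hR : 0 ≤ R) {x : ℕ → ℝ} {n : ℕ}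
    (hx : ∀ m ≤ n, |x m| ≤ R) (i l : ℕ) (hil : i + l ≤ n) :
    |shiftFilter κ i x l| ≤ (2 * κ) ^ i * R := by
  induction i generalizing l with
  | zero => simpa [shiftFilter] using hx l (by omega)
  | succ i ih =>
    have h1 := ih (l + 1) (by omega)
    have h2 := ih l (by omega)
    have h0 : 0 ≤ (2 * κ) ^ i * R := by positivity
    calc |shiftFilter κ (i + 1) x l| ≤ |shiftFilter κ i x (l + 1)| + κ * |shiftFilter κ i x l| := by
          rw [shiftFilter]
          refine (abs_add_le _ _).trans_eq ?_
          rw [abs_mul, abs_of_nonneg (by linarith : 0 ≤ κ)]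
      _ ≤ (2 * κ) ^ i * R + κ * ((2 * κ) ^ i * R) := by gcongr
      _ ≤ (2 * κ) ^ (i + 1) * R := by rw [pow_succ]; nlinarith

/-- The filters are undone by `σ = (σ + κ) - κ`. The loss depends on `κ`, which is harmless once `κ`
is fixed. -/
theorem abs_le_of_abs_shiftFilter_le {κ β : ℝ} (hκ : 0 ≤ κ) {x : ℕ → ℝ} {n : ℕ}
    (hx : ∀ i ≤ n, |shiftFilter κ i x 0| ≤ β) (l i : ℕ) (hil : i + l ≤ n) :
    |shiftFilter κ i x l| ≤ (1 + κ) ^ l * β := by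
  induction l generalizing i with
  | zero => simpa using hx i (by omega)
  | succ l ih =>
    have h1 := ih (i + 1) (by omega)
    have h2 := ih i (by omega)
    have h3 : shiftFilter κ i x (l + 1) = shiftFilter κ (i + 1) x l - κ * shiftFilter κ i x l := by
      rw [shiftFilter]; ring
    calc |shiftFilter κ i x (l + 1)| ≤ |shiftFilter κ (i + 1) x l| + κ * |shiftFilter κ i x l| := by
          rw [h3]
          refine (abs_sub _ _).trans_eq ?_
          rw [abs_mul, abs_of_nonneg hκ]
      _ ≤ (1 + κ) ^ l * β + κ * ((1 + κ) ^ l * β) := by gcongr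
      _ = (1 + κ) ^ (l + 1) * β := by ring

/-- `X₀, …, Xₛ` is a chain of integrators on `[0, b]`. -/
structure IsChainOn (s : ℕ) (X : ℕ → ℝ → ℝ) (b : ℝ) : Prop where
  cont : ∀ l ≤ s, ContinuousOn (X l) (Icc 0 b)
  deriv : ∀ l < s, ∀ t ∈ Ico 0 b, HasDerivWithinAt (X l) (X (l + 1) t) (Ici t) t

theorem IsChainOn.continuousOn_shiftFilter {s : ℕ} {X : ℕ → ℝ → ℝ} {b : ℝ}
    (h : IsChainOn s X b) (κ : ℝ) (i l : ℕ) (hil : i + l ≤ s) :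
    ContinuousOn (fun t => shiftFilter κ i (fun m => X m t) l) (Icc 0 b) := by
  induction i generalizing l with
  | zero => exact h.cont l (by omega)
  | succ i ih => exact (ih (l + 1) (by omega)).add ((ih l (by omega)).const_mul κ)

theorem IsChainOn.hasDerivWithinAt_shiftFilter {s : ℕ} {X : ℕ → ℝ → ℝ} {b : ℝ}
    (h : IsChainOn s X b) (κ : ℝ) (i l : ℕ) (hil : i + l < s) {t : ℝ} (ht : t ∈ Ico 0 b) :
    HasDerivWithinAt (fun t => shiftFilter κ i (fun m => X m t) l)
      (shiftFilter κ i (fun m => X m t) (l + 1)) (Ici t) t := by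
  induction i generalizing l with
  | zero => exact h.deriv l (by omega) t ht
  | succ i ih => exact (ih (l + 1) (by omega)).add ((ih l (by omega)).const_mul κ)

/-- Where `|y| ≥ V ≥ |u|`, the velocity `κ (u - y)` does not point outward. -/
theorem abs_le_of_filter {y u : ℝ → ℝ} {b κ V : ℝ} (hκ : 0 ≤ κ) (hy : ContinuousOn y (Icc 0 b))
    (hd : ∀ t ∈ Ico 0 b, HasDerivWithinAt y (κ * (u t - y t)) (Ici t) t)
    (hu : ∀ t ∈ Icc 0 b, |u t| ≤ V) (h0 : |y 0| ≤ V) : ∀ t ∈ Icc 0 b, |y t| ≤ V := by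
  intro t ht
  have h1 : DecreasesAbove y 0 b V 0 := decreasesAbove_of_hasDerivWithinAt hy hd fun r hr hle => by
    have := (abs_le.1 (hu r ⟨hr.1, hr.2.le⟩)).2
    nlinarith
  have h2 : DecreasesAbove (fun t => -y t) 0 b V 0 :=
    decreasesAbove_of_hasDerivWithinAt hy.neg (fun r hr => (hd r hr).neg) fun r hr hle => by
      have := (abs_le.1 (hu r ⟨hr.1, hr.2.le⟩)).1
      nlinarith
  simpa using abs_le_max_of_decreasesAbove hy le_rfl h1 h2 h0 t ht

/-- Where `|y| ≥ 2 β` and `|u| ≤ β`, `|y|` decreases at rate at least `κ β`; the settling time `V /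
(κ β)` therefore vanishes as `κ` grows. -/
theorem abs_le_two_mul_of_filter {y u : ℝ → ℝ} {b κ V β t₀ : ℝ} (hκ : 0 < κ) (hβ : 0 < β)
    (ht₀ : 0 ≤ t₀) (hy : ContinuousOn y (Icc 0 b))
    (hd : ∀ t ∈ Ico 0 b, HasDerivWithinAt y (κ * (u t - y t)) (Ici t) t)
    (hu : ∀ t ∈ Icc 0 b, t₀ ≤ t → |u t| ≤ β) (h0 : ∀ t ∈ Icc 0 b, |y t| ≤ V) :
    ∀ t ∈ Icc 0 b, t₀ + V / (κ * β) ≤ t → |y t| ≤ 2 * β := by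
  intro t ht htt
  have hV : 0 ≤ V := (abs_nonneg _).trans (h0 t ht)
  have htt₀ : t₀ ≤ t := by
    have : 0 ≤ V / (κ * β) := by positivity
    linarith
  have hsub : Icc t₀ b ⊆ Icc 0 b := Icc_subset_Icc_left ht₀
  have hc : 0 ≤ κ * β := by positivity
  have h1 : DecreasesAbove y t₀ b (2 * β) (κ * β) :=
    decreasesAbove_of_hasDerivWithinAt (hy.mono hsub)
      (fun r hr => hd r ⟨ht₀.trans hr.1, hr.2⟩) fun r hr hle => by
        have := (abs_le.1 (hu r ⟨ht₀.trans hr.1, hr.2.le⟩ hr.1)).2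
        nlinarith
  have h2 : DecreasesAbove (fun t => -y t) t₀ b (2 * β) (κ * β) :=
    decreasesAbove_of_hasDerivWithinAt (hy.mono hsub).neg
      (fun r hr => (hd r ⟨ht₀.trans hr.1, hr.2⟩).neg) fun r hr hle => by
        have := (abs_le.1 (hu r ⟨ht₀.trans hr.1, hr.2.le⟩ hr.1)).1
        nlinarith
  have h3 := abs_le_max_of_decreasesAbove (hy.mono hsub) hc h1 h2
    (h0 t₀ ⟨ht₀, htt₀.trans ht.2⟩) t ⟨htt₀, ht.2⟩
  refine h3.trans (max_le le_rfl ?_)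
  have h4 : V ≤ (t - t₀) * (κ * β) := by
    rw [← div_le_iff₀ (by positivity)]; linarith
  nlinarith

/-- In a chain of integrators with `κ ≥ 1`, bounds on the last filtered variable are inherited by
all the filtered variables `(D + κ)ⁱX₀ / κⁱ`. -/
theorem IsChainOn.abs_filtered_le {s : ℕ} {X : ℕ → ℝ → ℝ} {b κ V β t₀ : ℝ}
    (h : IsChainOn s X b) (hκ : 0 < κ) (hβ : 0 < β) (ht₀ : 0 ≤ t₀)
    (hinit : ∀ i ≤ s, |shiftFilter κ i (fun m => X m 0) 0 / κ ^ i| ≤ V)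
    (hV : ∀ t ∈ Icc 0 b, |shiftFilter κ s (fun m => X m t) 0 / κ ^ s| ≤ V)
    (hsmall : ∀ t ∈ Icc 0 b, t₀ ≤ t → |shiftFilter κ s (fun m => X m t) 0 / κ ^ s| ≤ β)
    (j i : ℕ) (hij : i + j = s) :
    ∀ t ∈ Icc 0 b, |shiftFilter κ i (fun m => X m t) 0 / κ ^ i| ≤ V ∧
      (t₀ + j * (V / (κ * β)) ≤ t → |shiftFilter κ i (fun m => X m t) 0 / κ ^ i| ≤ 2 ^ j * β) := by
  induction j generalizing i with
  | zero =>
    obtain rfl : i = s := by omega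
    intro t ht
    exact ⟨hV t ht, fun htt => by simpa using hsmall t ht (by simpa using htt)⟩
  -- The induction runs down the cascade from the input filter `i = s` to the output. Each stage
  -- doubles the final bound and takes at most `V / (κ β)` of time.
  | succ j ih =>
    have hih := ih (i + 1) (by omega)
    have hcont : ContinuousOn (fun t => shiftFilter κ i (fun m => X m t) 0 / κ ^ i) (Icc 0 b) :=
      (h.continuousOn_shiftFilter κ i 0 (by omega)).div_const _
    have hder : ∀ t ∈ Ico 0 b, HasDerivWithinAt
        (fun t => shiftFilter κ i (fun m => X m t) 0 / κ ^ i)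
        (κ * (shiftFilter κ (i + 1) (fun m => X m t) 0 / κ ^ (i + 1)
          - shiftFilter κ i (fun m => X m t) 0 / κ ^ i)) (Ici t) t := by
      intro t ht
      have h1 := (h.hasDerivWithinAt_shiftFilter κ i 0 (by omega) ht).div_const (κ ^ i)
      convert! h1 using 1
      rw [shiftFilter, pow_succ]
      field_simp
      ring
    have hbd := abs_le_of_filter hκ.le hcont hder (fun t ht => (hih t ht).1) (hinit i (by omega))
    intro t ht
    refine ⟨hbd t ht, fun htt => ?_⟩
    have hV0 : 0 ≤ V := (abs_nonneg _).trans (hbd t ht)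
    have h2 := abs_le_two_mul_of_filter (β := 2 ^ j * β) (t₀ := t₀ + j * (V / (κ * β))) hκ
      (by positivity) (by positivity) hcont hder (fun t ht => (hih t ht).2) hbd t ht (by
        have h3 : V / (κ * (2 ^ j * β)) ≤ V / (κ * β) := by
          apply div_le_div_of_nonneg_left hV0 (by positivity)
          have : (1 : ℝ) ≤ 2 ^ j := one_le_pow₀ (by norm_num)
          nlinarith [mul_pos hκ hβ]
        push_cast at htt
        linarith)
    rw [pow_succ]
    linarith

variable {E : Type*} [NormedAddCommGroup E] [NormedSpace ℝ E] [ProperSpace E]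

/-- For a suitable gain `κ`, the system `ż = f(z, X₀)` driven by a chain of integrators stays
bounded and becomes small, if `(D + κ)ˢX₀` is bounded at first and soon becomes small. -/
theorem exists_gain_chain {f : E × ℝ → E} (hf : LocallyLipschitz f)
    (hs : IsGloballyAsymptoticallyStable fun z => f (z, 0)) (s : ℕ) {R : ℝ} (hR : 0 < R) :
    ∃ κ : ℝ, 1 ≤ κ ∧ ∃ t₀ > 0, ∃ β > 0, ∃ M : ℝ,
      (∀ (z : ℝ → E) (X : ℕ → ℝ → ℝ) (b : ℝ), IsDrivenOn f z (X 0) b → IsChainOn s X b →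
        ‖z 0‖ ≤ R → (∀ l < s, |X l 0| ≤ R) →
        (∀ t ∈ Icc 0 b, |shiftFilter κ s (fun m => X m t) 0| ≤ (2 * κ) ^ s * R) →
        (∀ t ∈ Icc 0 b, t₀ ≤ t → |shiftFilter κ s (fun m => X m t) 0| ≤ β) →
        ∀ t ∈ Icc 0 b, ‖z t‖ ≤ M ∧ ∀ l ≤ s, |X l t| ≤ M) ∧
      ∀ ε > 0, ∃ β' > 0, ∃ T > 0,
        ∀ (z : ℝ → E) (X : ℕ → ℝ → ℝ) (b : ℝ), IsDrivenOn f z (X 0) b → IsChainOn s X b →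
        ‖z 0‖ ≤ R → (∀ l < s, |X l 0| ≤ R) →
        (∀ t ∈ Icc 0 b, |shiftFilter κ s (fun m => X m t) 0| ≤ (2 * κ) ^ s * R) →
        (∀ t ∈ Icc 0 b, t₀ ≤ t → |shiftFilter κ s (fun m => X m t) 0| ≤ min β β') →
        ∀ t ∈ Icc 0 b, T ≤ t → ‖z t‖ ≤ ε ∧ ∀ l ≤ s, |X l t| ≤ ε := by
  set V : ℝ := 2 ^ s * R
  have hV : 0 < V := by positivity
  obtain ⟨η, hη, t₁, ht₁, Mz, hMz⟩ := exists_bound_with_input hf hs R V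
  -- The division compensates for `s` doublings along the cascade.
  set β : ℝ := η / 2 ^ s
  have hβ : 0 < β := by positivity
  -- All `s` stages together settle within `t₁ / 2`; the first half of `t₁` is left for `(D + κ)ˢ
  -- X₀` itself to become small.
  set κ : ℝ := max 1 (2 * s * V / (β * t₁))
  have hκ1 : 1 ≤ κ := le_max_left _ _
  have hκ : 0 < κ := by linarith
  have hκt : s * (V / (κ * β)) ≤ t₁ / 2 := by
    have h1 : 2 * s * V / (β * t₁) ≤ κ := le_max_right _ _
    rw [div_le_iff₀ (by positivity)] at h1
    rw [← mul_div_assoc, div_le_div_iff₀ (by positivity) (by positivity)]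
    linarith
  have hpow : ∀ i : ℕ, 1 ≤ κ ^ i := fun i => one_le_pow₀ hκ1
  -- Bounds on the filtered variables, for any final accuracy.
  have hfil : ∀ (X : ℕ → ℝ → ℝ) (b : ℝ), IsChainOn s X b → (∀ l < s, |X l 0| ≤ R) →
      (∀ t ∈ Icc 0 b, |shiftFilter κ s (fun m => X m t) 0| ≤ (2 * κ) ^ s * R) →
      ∀ β' > 0, (∀ t ∈ Icc 0 b, t₁ / 2 ≤ t → |shiftFilter κ s (fun m => X m t) 0| ≤ β') →
      ∀ i ≤ s, ∀ t ∈ Icc 0 b, |shiftFilter κ i (fun m => X m t) 0 / κ ^ i| ≤ V ∧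
      (t₁ / 2 + s * (V / (κ * β')) ≤ t →
        |shiftFilter κ i (fun m => X m t) 0 / κ ^ i| ≤ 2 ^ s * β') := by
    intro X b hX hX0 hXV β' hβ' hXβ i hi t ht
    have hle : ∀ (i : ℕ) (r B : ℝ), |r| ≤ κ ^ i * B → |r / κ ^ i| ≤ B := by
      intro i r B h
      rw [abs_div, abs_of_pos (by positivity : 0 < κ ^ i), div_le_iff₀ (by positivity)]
      linarith
    have h2V : ∀ i ≤ s, 2 ^ i * R ≤ V := fun i hi => by
      have : (2 : ℝ) ^ i ≤ 2 ^ s := pow_le_pow_right₀ (by norm_num) hi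
      exact mul_le_mul_of_nonneg_right this hR.le
    have := hX.abs_filtered_le (V := V) (β := β') (t₀ := t₁ / 2) hκ hβ' (by positivity)
      (fun i hi => hle _ _ _ (by
        have h1 : |shiftFilter κ i (fun m => X m 0) 0| ≤ (2 * κ) ^ i * R := by
          rcases hi.eq_or_lt with rfl | hlt
          · exact hXV 0 ⟨le_rfl, ht.1.trans ht.2⟩
          · exact abs_shiftFilter_le (n := i) hκ1 hR.le (fun m hm => hX0 m (by omega)) i 0 le_rfl
        refine h1.trans ?_
        rw [mul_pow, mul_comm (2 ^ i), mul_assoc]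
        exact mul_le_mul_of_nonneg_left (h2V i hi) (by positivity)))
      (fun t ht => hle _ _ _ ((hXV t ht).trans (by
        rw [mul_pow, mul_comm (2 ^ s), mul_assoc])))
      (fun t ht htt => hle _ _ _ ((hXβ t ht htt).trans
        (le_mul_of_one_le_left hβ'.le (hpow s))))
      (s - i) i (by omega) t ht
    refine ⟨this.1, fun htt => (this.2 ?_).trans ?_⟩
    · have h1 : ((s - i : ℕ) : ℝ) ≤ s := by exact_mod_cast Nat.sub_le s i
      have h2 : 0 ≤ V / (κ * β') := by positivity
      nlinarith
    · have : (2 : ℝ) ^ (s - i) ≤ 2 ^ s := pow_le_pow_right₀ (by norm_num) (Nat.sub_le s i)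
      exact mul_le_mul_of_nonneg_right this hβ'.le
  -- Bounds on the filtered variables bound the chain.
  have hback : ∀ (x : ℕ → ℝ) (B : ℝ), 0 ≤ B → (∀ i ≤ s, |shiftFilter κ i x 0 / κ ^ i| ≤ B) →
      ∀ l ≤ s, |x l| ≤ (1 + κ) ^ s * (κ ^ s * B) := by
    intro x B hB h l hl
    have h1 : ∀ i ≤ s, |shiftFilter κ i x 0| ≤ κ ^ s * B := fun i hi => by
      have := h i hi
      rw [abs_div, abs_of_pos (by positivity : 0 < κ ^ i), div_le_iff₀ (by positivity)] at this
      have h2 : κ ^ i ≤ κ ^ s := pow_le_pow_right₀ hκ1 hi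
      nlinarith
    have h2 := abs_le_of_abs_shiftFilter_le hκ.le h1 l 0 (by omega)
    refine h2.trans ?_
    have h3 : (1 + κ) ^ l ≤ (1 + κ) ^ s := pow_le_pow_right₀ (by linarith) hl
    exact mul_le_mul_of_nonneg_right h3 (by positivity)
  set M := max Mz ((1 + κ) ^ s * (κ ^ s * V))
  have hA : ∀ (z : ℝ → E) (X : ℕ → ℝ → ℝ) (b : ℝ), IsDrivenOn f z (X 0) b → IsChainOn s X b →
        ‖z 0‖ ≤ R → (∀ l < s, |X l 0| ≤ R) →
        (∀ t ∈ Icc 0 b, |shiftFilter κ s (fun m => X m t) 0| ≤ (2 * κ) ^ s * R) →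
        (∀ t ∈ Icc 0 b, t₁ / 2 ≤ t → |shiftFilter κ s (fun m => X m t) 0| ≤ β) →
        ∀ t ∈ Icc 0 b, ‖z t‖ ≤ M ∧ ∀ l ≤ s, |X l t| ≤ M := by
    intro z X b hz hX hz0 hX0 hXV hXβ t ht
    have h := hfil X b hX hX0 hXV β hβ hXβ
    constructor
    · refine (hMz z (X 0) b hz hz0 (fun t ht => ?_) (fun t ht htt => ?_) t ht).trans
        (le_max_left _ _)
      · simpa [shiftFilter] using (h 0 (Nat.zero_le _) t ht).1
      · have h2 : (2 : ℝ) ^ s * β = η := by simp only [β]; field_simp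
        rw [← h2]
        simpa [shiftFilter] using (h 0 (Nat.zero_le _) t ht).2 (by linarith)
    · intro l hl
      exact (hback (fun m => X m t) V hV.le (fun i hi => (h i hi t ht).1) l hl).trans
        (le_max_right _ _)
  refine ⟨κ, hκ1, t₁ / 2, by positivity, β, hβ, M, hA, fun ε hε => ?_⟩
  -- For the final accuracy `z` is restarted at the time `T₁` at which the cascade has settled; by
  -- then `z` is only known to be bounded by `M`, so attraction is used from that radius.
  obtain ⟨η', hη', T', hT', M', hM'⟩ := exists_attracted_with_input hf hs M hε
  set c : ℝ := (1 + κ) ^ s * (κ ^ s * 2 ^ s) with hc_def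
  have hc : 0 < c := by positivity
  set β' : ℝ := min (η' / 2 ^ s) (ε / c)
  have hβ' : 0 < β' := by positivity
  have hβη : 2 ^ s * β' ≤ η' := by
    have : β' ≤ η' / 2 ^ s := min_le_left _ _
    rw [le_div_iff₀ (by positivity)] at this
    linarith
  have hβε : c * β' ≤ ε := by
    have : β' ≤ ε / c := min_le_right _ _
    rw [le_div_iff₀ (by positivity)] at this
    linarith
  set T₁ := t₁ / 2 + s * (V / (κ * β'))
  have hT₁ : 0 < T₁ := by positivity
  refine ⟨β', hβ', T₁ + T', by positivity, fun z X b hz hX hz0 hX0 hXV hXβ t ht htT => ?_⟩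
  have h := hfil X b hX hX0 hXV β' hβ' fun t ht htt => (hXβ t ht htt).trans (min_le_right _ _)
  have hMb := hA z X b hz hX hz0 hX0 hXV fun t ht htt => (hXβ t ht htt).trans (min_le_left _ _)
  constructor
  · have := hM' _ _ _ (hz.shift hT₁.le)
      (by simpa using (hMb T₁ ⟨hT₁.le, by linarith [ht.2]⟩).1)
      (fun r hr => by
        have h1 := (h 0 (Nat.zero_le _) (r + T₁) ⟨by linarith [hr.1], by linarith [hr.2]⟩).2
          (show T₁ ≤ r + T₁ by linarith [hr.1])
        simp only [shiftFilter, pow_zero, div_one] at h1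
        exact h1.trans hβη) (t - T₁) ⟨by linarith, by linarith [ht.2]⟩
    simpa using this.2 (by linarith)
  · intro l hl
    refine (hback (fun m => X m t) (2 ^ s * β') (by positivity)
      (fun i hi => (h i hi t ht).2 (show T₁ ≤ t by linarith)) l hl).trans ?_
    calc (1 + κ) ^ s * (κ ^ s * (2 ^ s * β')) = c * β' := by rw [hc_def]; ring
      _ ≤ ε := hβε

end QuantizedControl

namespace QuantizedControl

/-! ### Global solutions -/

section Global

variable {E : Type*} [NormedAddCommGroup E] [NormedSpace ℝ E]

/-- A bounded Lipschitz vector field has a global forward solution. -/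
theorem exists_isForwardSolution_of_lipschitzWith [CompleteSpace E] {G : E → E} {K : NNReal}
    (hG : LipschitzWith K G) {B : ℝ} (hB : ∀ x, ‖G x‖ ≤ B) (x₀ : E) :
    ∃ x, IsForwardSolution G x ∧ x 0 = x₀ := by
  have hB0 : 0 ≤ B := (norm_nonneg _).trans (hB 0)
  have hPL : ∀ n : ℕ, ∃ α : ℝ → E, α 0 = x₀ ∧
      ∀ t ∈ Icc (0 : ℝ) n, HasDerivWithinAt α (G (α t)) (Icc 0 n) t := by
    intro n
    have h0 : (0 : ℝ) ∈ Icc (0 : ℝ) n := ⟨le_rfl, Nat.cast_nonneg n⟩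
    -- With speed at most `B`, the ball of radius `B * n` cannot be left before time `n`, so there
    -- is a solution on all of `[0, n]`.
    have : IsPicardLindelof (fun _ => G) (⟨0, h0⟩ : Icc (0 : ℝ) n) x₀ (B.toNNReal * n) 0
        B.toNNReal K :=
      { lipschitzOnWith := fun _ _ => hG.lipschitzOnWith
        continuousOn := fun _ _ => continuousOn_const
        norm_le := fun _ _ x _ => by rw [Real.coe_toNNReal _ hB0]; exact hB x
        mul_max_le := by simp }
    exact this.exists_eq_forall_mem_Icc_hasDerivWithinAt₀
  choose α hα0 hα using hPL
  have hcont : ∀ n : ℕ, ContinuousOn (α n) (Icc 0 n) := fun n t ht =>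
    (hα n t ht).continuousWithinAt
  have hderiv : ∀ n : ℕ, ∀ t ∈ Ico (0 : ℝ) n, HasDerivWithinAt (α n) (G (α n t)) (Ici t) t :=
    fun n t ht => (hα n t ⟨ht.1, ht.2.le⟩).mono_of_mem_nhdsWithin (Icc_mem_nhdsGE_of_mem ht)
  have huniq : ∀ (n n' : ℕ) (t : ℝ), 0 ≤ t → t ≤ n → t ≤ n' → α n t = α n' t := by
    intro n n' t h0 hn hn'
    exact ODE_solution_unique_of_mem_Icc_right (v := fun _ => G) (s := fun _ => univ) (K := K)
      (a := 0) (b := t) (fun _ _ => hG.lipschitzOnWith)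
      ((hcont n).mono (Icc_subset_Icc_right hn))
      (fun r hr => hderiv n r ⟨hr.1, hr.2.trans_le hn⟩) (fun _ _ => mem_univ _)
      ((hcont n').mono (Icc_subset_Icc_right hn'))
      (fun r hr => hderiv n' r ⟨hr.1, hr.2.trans_le hn'⟩) (fun _ _ => mem_univ _)
      (by rw [hα0, hα0]) ⟨h0, le_rfl⟩
  have hx : ∀ (n : ℕ) (t : ℝ), 0 ≤ t → t ≤ n → α ⌈t⌉₊ t = α n t := fun n t h0 hn =>
    huniq _ _ _ h0 (Nat.le_ceil t) hn
  -- By uniqueness the solutions on the intervals `[0, n]` agree where they overlap, and evaluating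
  -- the one with index `⌈t⌉₊` glues them.
  refine ⟨fun t => α ⌈t⌉₊ t, fun t ht => ?_, by simp [hα0]⟩
  set n := ⌈t⌉₊ + 1
  have htn : t < n := by
    have := Nat.le_ceil t
    simp only [n, Nat.cast_add, Nat.cast_one]
    linarith
  have h1 : Icc (0 : ℝ) n ∈ 𝓝[Ici 0] t := by
    rw [← Ici_inter_Iic]
    exact inter_mem_nhdsWithin _ (Iic_mem_nhds htn)
  have h2 : HasDerivWithinAt (α n) (G (α n t)) (Ici 0) t :=
    (hα n t ⟨ht, htn.le⟩).mono_of_mem_nhdsWithin h1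
  have h3 : α ⌈t⌉₊ t = α n t := hx n t ht htn.le
  show HasDerivWithinAt (fun t => α ⌈t⌉₊ t) (G (α ⌈t⌉₊ t)) (Ici 0) t
  rw [h3]
  refine h2.congr_of_eventuallyEq ?_ h3
  filter_upwards [h1] with r hr
  exact hx n r hr.1 hr.2

/-- The cut-off of a locally Lipschitz vector field is bounded and Lipschitz. -/
theorem exists_lipschitzWith_eqOn_closedBall [ProperSpace E] {F : E → E} (hF : LocallyLipschitz F)
    (N : ℝ) : ∃ (G : E → E) (K : NNReal) (B : ℝ), LipschitzWith K G ∧ (∀ x, ‖G x‖ ≤ B) ∧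
      ∀ x, ‖x‖ ≤ N → G x = F x := by
  obtain ⟨K, hK⟩ := exists_lipschitzOnWith_of_isCompact hF (isCompact_closedBall (0 : E) (N + 1))
  obtain ⟨B, hB0, hB⟩ := exists_norm_le_of_isCompact hF.continuous
    (isCompact_closedBall (0 : E) (N + 1))
  -- A 1-Lipschitz cut-off, equal to `1` up to radius `N` and to `0` beyond `N + 1`.
  set χ : E → ℝ := fun x => max 0 (min 1 (N + 1 - ‖x‖))
  have hχ0 : ∀ x, 0 ≤ χ x := fun x => le_max_left _ _
  have hχ1 : ∀ x, χ x ≤ 1 := fun x => max_le zero_le_one (min_le_left _ _)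
  have hχout : ∀ x, N + 1 < ‖x‖ → χ x = 0 := fun x hx =>
    max_eq_left ((min_le_right _ _).trans (by linarith))
  have hχin : ∀ x, ‖x‖ ≤ N → χ x = 1 := fun x hx => by
    simp only [χ]
    rw [min_eq_left (by linarith), max_eq_right zero_le_one]
  have hχL : ∀ x y, |χ x - χ y| ≤ ‖x - y‖ := fun x y => by
    have h1 : |χ x - χ y| ≤ |min 1 (N + 1 - ‖x‖) - min 1 (N + 1 - ‖y‖)| := by
      simpa [max_comm] using
        abs_max_sub_max_le_abs (min 1 (N + 1 - ‖x‖)) (min 1 (N + 1 - ‖y‖)) 0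
    have h2 : |min 1 (N + 1 - ‖x‖) - min 1 (N + 1 - ‖y‖)| ≤
        |(N + 1 - ‖x‖) - (N + 1 - ‖y‖)| := by
      simpa using abs_min_sub_min_le_max 1 (N + 1 - ‖x‖) 1 (N + 1 - ‖y‖)
    have h3 : |(N + 1 - ‖x‖) - (N + 1 - ‖y‖)| ≤ ‖x - y‖ := by
      rw [show (N + 1 - ‖x‖) - (N + 1 - ‖y‖) = -(‖x‖ - ‖y‖) by ring, abs_neg]
      exact abs_norm_sub_norm_le x y
    exact h1.trans (h2.trans h3)
  have hbd : ∀ x, ‖χ x • F x‖ ≤ χ x * B := fun x => by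
    rw [norm_smul, Real.norm_of_nonneg (hχ0 x)]
    by_cases hx : ‖x‖ ≤ N + 1
    · exact mul_le_mul_of_nonneg_left (hB x (by simpa using hx)) (hχ0 x)
    · rw [hχout x (not_le.1 hx)]; simp
  refine ⟨fun x => χ x • F x, K + B.toNNReal, B, LipschitzWith.of_dist_le_mul fun x y => ?_,
    fun x => (hbd x).trans (mul_le_of_le_one_left hB0.le (hχ1 x)),
    fun x hx => by simp only [hχin x hx, one_smul]⟩
  rw [dist_eq_norm, dist_eq_norm, NNReal.coe_add, Real.coe_toNNReal _ hB0.le]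
  have hK0 : 0 ≤ (K : ℝ) * ‖x - y‖ := by positivity
  by_cases hx : ‖x‖ ≤ N + 1
  · by_cases hy : ‖y‖ ≤ N + 1
    · have h1 : χ x • F x - χ y • F y = χ x • (F x - F y) + (χ x - χ y) • F y := by
        rw [smul_sub, sub_smul]; abel
      have h2 : ‖F x - F y‖ ≤ K * ‖x - y‖ := by
        simpa [dist_eq_norm] using hK.dist_le_mul x (by simpa using hx) y (by simpa using hy)
      calc ‖χ x • F x - χ y • F y‖ ≤ ‖χ x • (F x - F y)‖ + ‖(χ x - χ y) • F y‖ := by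
            rw [h1]; exact norm_add_le _ _
        _ = χ x * ‖F x - F y‖ + |χ x - χ y| * ‖F y‖ := by
            rw [norm_smul, norm_smul, Real.norm_of_nonneg (hχ0 x), Real.norm_eq_abs]
        _ ≤ 1 * (K * ‖x - y‖) + ‖x - y‖ * B := by
            gcongr
            · exact hχ1 x
            · exact hχL x y
            · exact hB y (by simpa using hy)
        _ = (K + B) * ‖x - y‖ := by ring
    -- If one point lies outside the support, the Lipschitz bound on `χ` alone controls the other
    -- value: `χ x * B ≤ ‖x - y‖ * B`.
    · have hy0 := hχout y (not_le.1 hy)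
      have h1 := hχL x y
      rw [hy0, sub_zero, abs_of_nonneg (hχ0 x)] at h1
      have h2 := hbd x
      simp only [hy0, zero_smul, sub_zero]
      nlinarith
  · have hx0 := hχout x (not_le.1 hx)
    have h1 := hχL x y
    rw [hx0, zero_sub, abs_neg, abs_of_nonneg (hχ0 y)] at h1
    have h2 := hbd y
    simp only [hx0, zero_smul, zero_sub, norm_neg]
    nlinarith

/-- An a priori bound yields a global forward solution. -/
theorem exists_isForwardSolution_of_bound [ProperSpace E] {F : E → E} (hF : LocallyLipschitz F)
    (x₀ : E) (M : ℝ)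
    (hM : ∀ (x : ℝ → E) (b : ℝ), x 0 = x₀ → ContinuousOn x (Icc 0 b) →
      (∀ t ∈ Ico 0 b, HasDerivWithinAt x (F (x t)) (Ici t) t) → ∀ t ∈ Icc 0 b, ‖x t‖ ≤ M) :
    ∃ x, IsForwardSolution F x ∧ x 0 = x₀ := by
  obtain ⟨G, K, B, hG, hB, hGF⟩ := exists_lipschitzWith_eqOn_closedBall hF (M + 1)
  obtain ⟨x, hx, hx0⟩ := exists_isForwardSolution_of_lipschitzWith hG hB x₀
  have hM0 : ‖x 0‖ ≤ M := hM x 0 hx0 (by simp) (by simp) 0 (by simp)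
  refine ⟨x, fun t ht => ?_, hx0⟩
  have hxc : ContinuousOn x (Icc 0 t) := hx.continuousOn.mono Icc_subset_Ici_self
  have := lt_of_forall_le_imp_lt (g := fun t => ‖x t‖) (e := M + 1) hxc.norm
    (fun _ => by linarith) (fun s hs hle => by
      have := hM x s hx0 (hxc.mono (Icc_subset_Icc_right hs.2)) (fun r hr => by
        rw [← hGF (x r) (hle r ⟨hr.1, hr.2.le⟩)]
        exact hx.hasDerivWithinAt_Ici hr.1) s ⟨hs.1, le_rfl⟩
      linarith) t ⟨ht, le_rfl⟩
  rw [← hGF (x t) this.le]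
  exact hx t ht

end Global

/-! ### The reduced system -/

theorem mem_cube_iff {m k : ℕ} {R : ℝ} (hR : 0 ≤ R) {p : State m k} :
    p ∈ cube R ↔ ‖p‖ ≤ R := by
  rw [norm_prod_le_iff, pi_norm_le_iff_of_nonneg hR, pi_norm_le_iff_of_nonneg hR]
  rfl

/-- A vector as a sequence, with zeros appended. -/
def extendZero {k : ℕ} (ξ : Fin k → ℝ) (l : ℕ) : ℝ := if h : l < k then ξ ⟨l, h⟩ else 0

theorem extendZero_of_lt {k : ℕ} (ξ : Fin k → ℝ) {l : ℕ} (h : l < k) :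
    extendZero ξ l = ξ ⟨l, h⟩ := dif_pos h

theorem extendZero_val {k : ℕ} (ξ : Fin k → ℝ) (i : Fin k) : extendZero ξ i = ξ i :=
  extendZero_of_lt ξ i.2

/-- `a` is the row of coefficients of `(D + κ)ˢ - Dˢ`. -/
def IsGain {s : ℕ} (κ : ℝ) (a : Fin s → ℝ) : Prop :=
  ∀ (m : ℕ) (p : State m (s + 1)), zeta a p = shiftFilter κ s (extendZero p.2) 0

theorem exists_isGain (s : ℕ) (κ : ℝ) : ∃ a : Fin s → ℝ, IsGain κ a := by
  obtain ⟨a, ha⟩ := exists_shiftFilter_eq_sum κ s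
  refine ⟨fun i => a i, fun m p => ?_⟩
  rw [ha, zeta, ← Fin.sum_univ_eq_sum_range (fun i => a i * extendZero p.2 (0 + i))]
  simp only [zero_add]
  congr 1
  · refine Finset.sum_congr rfl fun i _ => ?_
    rw [extendZero_of_lt p.2 (i.2.trans (Nat.lt_succ_self s))]
    rfl
  · rw [extendZero_of_lt p.2 (Nat.lt_succ_self s)]
    rfl

section Reduced

variable {m s : ℕ} {f : (Fin m → ℝ) × ℝ → (Fin m → ℝ)} {a : Fin s → ℝ}

/-- The state of the full system on the manifold `ζ = 0` above a state of the reduced system. -/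
def reducedLift (a : Fin s → ℝ) (p : State m s) : State m (s + 1) :=
  (p.1, Fin.snoc (α := fun _ => ℝ) p.2 (-∑ i, a i * p.2 i))

theorem zeta_reducedLift (a : Fin s → ℝ) (p : State m s) : zeta a (reducedLift a p) = 0 := by
  simp [zeta, reducedLift]

theorem contDiff_reducedLift_snd (a : Fin s → ℝ) (i : Fin (s + 1)) :
    ContDiff ℝ 1 fun p : State m s => (reducedLift a p).2 i := by
  refine Fin.lastCases ?_ (fun i => ?_) i
  · simp only [reducedLift, Fin.snoc_last]
    fun_prop
  · simp only [reducedLift, Fin.snoc_castSucc]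
    fun_prop

theorem locallyLipschitz_reducedField (hf : LocallyLipschitz f) (a : Fin s → ℝ) :
    LocallyLipschitz (reducedField f a) := by
  have h1 : ContDiff ℝ 1 fun p : State m s => (p.1, (reducedLift a p).2 0) :=
    contDiff_fst.prodMk (contDiff_reducedLift_snd a 0)
  have h2 : ContDiff ℝ 1 fun p : State m s => fun i : Fin s => (reducedLift a p).2 i.succ :=
    contDiff_pi.2 fun i => contDiff_reducedLift_snd a i.succ
  exact (hf.comp h1.locallyLipschitz).prodMk h2.locallyLipschitz

/-- Lifted to `ζ = 0`, the reduced system is a chain of integrators whose filtered signal vanishes,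
so the estimates for chains also yield its global existence and convergence. -/
theorem reduced_isDrivenOn_isChainOn {x : ℝ → State m s} {b : ℝ} (hx : ContinuousOn x (Icc 0 b))
    (hd : ∀ t ∈ Ico 0 b, HasDerivWithinAt x (reducedField f a (x t)) (Ici t) t) :
    IsDrivenOn f (fun t => (x t).1) (fun t => extendZero (reducedLift a (x t)).2 0) b ∧
      IsChainOn s (fun l t => extendZero (reducedLift a (x t)).2 l) b := by
  refine ⟨⟨hx.fst, fun t ht => ?_⟩, ⟨fun l hl => ?_, fun l hl t ht => ?_⟩⟩
  · have h := (hd t ht).hasFDerivWithinAt.fst.hasDerivWithinAt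
    rw [extendZero_of_lt _ (Nat.succ_pos s)]
    simpa [reducedField, reducedLift] using h
  · have hl' : l < s + 1 := by omega
    simp only [extendZero_of_lt _ hl']
    exact (contDiff_reducedLift_snd a ⟨l, hl'⟩).continuous.comp_continuousOn hx
  · have h := (hd t ht).hasFDerivWithinAt.snd.hasDerivWithinAt
    have h' := hasDerivWithinAt_pi.1 h ⟨l, hl⟩
    have hl1 : l < s + 1 := by omega
    have hl2 : l + 1 < s + 1 := by omega
    simp only [extendZero_of_lt _ hl1, extendZero_of_lt _ hl2]
    have h3 : ∀ r, (reducedLift a (x r)).2 ⟨l, hl1⟩ = (x r).2 ⟨l, hl⟩ := fun r => by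
      have : (⟨l, hl1⟩ : Fin (s + 1)) = Fin.castSucc ⟨l, hl⟩ := rfl
      rw [this]; simp only [reducedLift, Fin.snoc_castSucc]
    simp only [h3]
    simpa [reducedField, reducedLift] using h'

end Reduced

end QuantizedControl

namespace QuantizedControl

/-! ### Trajectories pushed towards `ζ = 0` -/

theorem AbsolutelyContinuousOnInterval.lipschitz_comp {X Y : Type*} [PseudoMetricSpace X]
    [PseudoMetricSpace Y] {g : X → Y} {K : NNReal} (hg : LipschitzWith K g) {φ : ℝ → X} {a b : ℝ}
    (hφ : AbsolutelyContinuousOnInterval φ a b) :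
    AbsolutelyContinuousOnInterval (fun t => g (φ t)) a b := by
  have h : Tendsto (fun E : ℕ × (ℕ → ℝ × ℝ) =>
      (K : ℝ) * ∑ i ∈ Finset.range E.1, dist (φ (E.2 i).1) (φ (E.2 i).2)) _ (𝓝 (K * 0)) :=
    Tendsto.const_mul (K : ℝ) hφ
  rw [mul_zero] at h
  refine squeeze_zero (fun E => Finset.sum_nonneg fun _ _ => dist_nonneg) (fun E => ?_) h
  rw [Finset.mul_sum]
  exact Finset.sum_le_sum fun i _ => hg.dist_le_mul _ _

variable {m s : ℕ} {f : (Fin m → ℝ) × ℝ → (Fin m → ℝ)} {q b : State m (s + 1) → ℝ} {a : Fin s → ℝ}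

/-- The measurement `ζ` as a continuous linear functional. -/
noncomputable def zetaL (m : ℕ) (a : Fin s → ℝ) : State m (s + 1) →L[ℝ] ℝ :=
  LinearMap.toContinuousLinearMap
    { toFun := zeta a
      map_add' := fun p p' => by
        simp only [zeta, Prod.snd_add, Pi.add_apply, mul_add, Finset.sum_add_distrib]; ring
      map_smul' := fun c p => by
        simp only [zeta, Prod.smul_snd, Pi.smul_apply, smul_eq_mul, RingHom.id_apply, mul_add,
          Finset.mul_sum]
        congr 1
        exact Finset.sum_congr rfl fun i _ => by ring }

theorem zetaL_apply (a : Fin s → ℝ) (p : State m (s + 1)) : zetaL m a p = zeta a p := rfl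

theorem continuous_zeta (a : Fin s → ℝ) : Continuous (zeta (m := m) a) := (zetaL m a).continuous

/-- The velocity whose last component is `c`, the other ones being those of the normal form. -/
def velocity (f : (Fin m → ℝ) × ℝ → (Fin m → ℝ)) (p : State m (s + 1)) (c : ℝ) : State m (s + 1) :=
  (f (p.1, p.2 0), Fin.snoc (α := fun _ => ℝ) (fun i : Fin s => p.2 i.succ) c)

theorem zeta_velocity (a : Fin s → ℝ) (p : State m (s + 1)) (c : ℝ) :
    zeta a (velocity f p c) = ∑ i, a i * p.2 i.succ + c := by
  simp [zeta, velocity]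

/-- `φ` moves along a chain of integrators driving `z`, with a last component that pushes `ζ`
towards the dead zone `|ζ| ≤ η`. -/
structure IsPushedTrajectory (f : (Fin m → ℝ) × ℝ → (Fin m → ℝ)) (q : State m (s + 1) → ℝ)
    (a : Fin s → ℝ) (η C : ℝ) (τ : EReal) (φ : ℝ → State m (s + 1)) : Prop where
  absCont : ∀ t : ℝ, 0 ≤ t → (t : EReal) < τ → AbsolutelyContinuousOnInterval φ 0 t
  push : ∀ᵐ t : ℝ, 0 < t → (t : EReal) < τ → ∃ c, HasDerivAt φ (velocity f (φ t) c) t ∧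
    (η < zeta a (φ t) → c ≤ q (φ t) + 1 - C) ∧ (zeta a (φ t) < -η → q (φ t) - 1 + C ≤ c)

namespace IsPushedTrajectory

variable {η C : ℝ} {τ : EReal} {φ : ℝ → State m (s + 1)}

theorem continuousOn (h : IsPushedTrajectory f q a η C τ φ) {t₁ : ℝ} (h0 : 0 ≤ t₁)
    (h1 : (t₁ : EReal) < τ) : ContinuousOn φ (Icc 0 t₁) := by
  have := (h.absCont t₁ h0 h1).continuousOn
  rwa [uIcc_of_le h0] at this

/-- Only the last velocity component can be discontinuous. The others are continuous along the
trajectory, so their almost-everywhere derivatives are right derivatives at every time and the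
classical lemmas apply. -/
theorem isDrivenOn_isChainOn (h : IsPushedTrajectory f q a η C τ φ) (hf : Continuous f) {t₁ : ℝ}
    (h0 : 0 ≤ t₁) (h1 : (t₁ : EReal) < τ) :
    IsDrivenOn f (fun t => (φ t).1) (fun t => extendZero (φ t).2 0) t₁ ∧
      IsChainOn s (fun l t => extendZero (φ t).2 l) t₁ := by
  have hac := h.absCont t₁ h0 h1
  have hc := h.continuousOn h0 h1
  have hcomp : ∀ i, ContinuousOn (fun t => (φ t).2 i) (Icc 0 t₁) := fun i =>
    (continuous_apply i).comp_continuousOn hc.snd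
  have hpush : ∀ᵐ t : ℝ, t ∈ Ioo 0 t₁ → ∃ c, HasDerivAt φ (velocity f (φ t) c) t := by
    filter_upwards [h.push] with t ht hmem
    obtain ⟨c, hcd, -⟩ := ht hmem.1 ((EReal.coe_lt_coe_iff.2 hmem.2).trans h1)
    exact ⟨c, hcd⟩
  refine ⟨⟨hc.fst, fun t ht => ?_⟩, ⟨fun l hl => ?_, fun l hl t ht => ?_⟩⟩
  · have hy : AbsolutelyContinuousOnInterval (fun t => (φ t).1) 0 t₁ :=
      AbsolutelyContinuousOnInterval.lipschitz_comp LipschitzWith.prod_fst hac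
    rw [extendZero_of_lt _ (Nat.succ_pos s)]
    refine hasDerivWithinAt_Ici_of_ae (h := fun t => f ((φ t).1, (φ t).2 0)) hy
      (hf.comp_continuousOn (hc.fst.prodMk (hcomp 0))) ?_ t ht
    filter_upwards [hpush] with r hr hmem
    obtain ⟨c, hcd⟩ := hr hmem
    exact hcd.hasFDerivAt.fst.hasDerivAt.congr_deriv (by simp [velocity])
  · have hl' : l < s + 1 := by omega
    simp only [extendZero_of_lt _ hl']
    exact hcomp _
  · have hl1 : l < s + 1 := by omega
    have hl2 : l + 1 < s + 1 := by omega
    simp only [extendZero_of_lt _ hl1, extendZero_of_lt _ hl2]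
    have hy : AbsolutelyContinuousOnInterval (fun t => (φ t).2 ⟨l, hl1⟩) 0 t₁ :=
      AbsolutelyContinuousOnInterval.lipschitz_comp
        (g := fun p : State m (s + 1) => p.2 ⟨l, hl1⟩) (K := 1)
        (LipschitzWith.of_dist_le_mul fun p p' => by
          rw [NNReal.coe_one, one_mul]
          exact (dist_le_pi_dist p.2 p'.2 _).trans (le_max_right _ _)) hac
    refine hasDerivWithinAt_Ici_of_ae (h := fun t => (φ t).2 ⟨l + 1, hl2⟩) hy (hcomp _) ?_ t ht
    filter_upwards [hpush] with r hr hmem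
    obtain ⟨c, hcd⟩ := hr hmem
    have h2 := hasDerivAt_pi.1 hcd.hasFDerivAt.snd.hasDerivAt ⟨l, hl1⟩
    refine h2.congr_deriv ?_
    have h3 : (velocity f (φ r) c).2 (Fin.castSucc ⟨l, hl⟩) = (φ r).2 ⟨l + 1, hl2⟩ :=
      Fin.snoc_castSucc (α := fun _ => ℝ) (n := s) c (fun i => (φ r).2 i.succ) ⟨l, hl⟩
    rw [← h3]
    simp

/-- In `ζ' = ∑ aᵢ ξᵢ₊₁ + c` the push dominates the drift: everything except `C` is bounded by `L`,
which leaves the rate `C - L`. -/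
theorem abs_zeta_le (h : IsPushedTrajectory f q a η C τ φ) {t₁ Z c L : ℝ} (h0 : 0 ≤ t₁)
    (h1 : (t₁ : EReal) < τ) (hc : 0 ≤ c) (hLC : L + c ≤ C)
    (hL : ∀ t ∈ Icc 0 t₁, |∑ i, a i * (φ t).2 i.succ| + |q (φ t)| + 1 ≤ L)
    (hZ : |zeta a (φ 0)| ≤ Z) : ∀ t ∈ Icc 0 t₁, |zeta a (φ t)| ≤ max η (Z - c * t) := by
  have hcont : ContinuousOn (fun t => zeta a (φ t)) (Icc 0 t₁) :=
    (continuous_zeta a).comp_continuousOn (h.continuousOn h0 h1)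
  have hac : AbsolutelyContinuousOnInterval (fun t => zeta a (φ t)) 0 t₁ :=
    AbsolutelyContinuousOnInterval.lipschitz_comp (zetaL m a).lipschitz (h.absCont t₁ h0 h1)
  have hd : ∀ᵐ t : ℝ, t ∈ Ioo 0 t₁ → ∃ p, HasDerivAt (fun t => zeta a (φ t)) p t ∧
      (η < zeta a (φ t) → p ≤ -c) ∧ (zeta a (φ t) < -η → c ≤ p) := by
    filter_upwards [h.push] with t ht hmem
    obtain ⟨v, hv, hv1, hv2⟩ := ht hmem.1 ((EReal.coe_lt_coe_iff.2 hmem.2).trans h1)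
    have hLt := hL t ⟨hmem.1.le, hmem.2.le⟩
    have hs1 := abs_le.1 (le_refl |∑ i, a i * (φ t).2 i.succ|)
    have hq1 := abs_le.1 (le_refl |q (φ t)|)
    refine ⟨∑ i, a i * (φ t).2 i.succ + v, ?_, fun hη => ?_, fun hη => ?_⟩
    · have := (zetaL m a).hasFDerivAt.comp_hasDerivAt t hv
      rwa [zetaL_apply, zeta_velocity] at this
    · linarith [hv1 hη, hs1.2, hq1.2]
    · linarith [hv2 hη, hs1.1, hq1.1]
  have hdec : DecreasesAbove (fun t => zeta a (φ t)) 0 t₁ η c := by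
    refine decreasesAbove_of_absolutelyContinuous hac ?_
    filter_upwards [hd] with t ht hmem
    obtain ⟨p, hp, hp1, -⟩ := ht hmem
    exact ⟨p, hp, hp1⟩
  have hdec' : DecreasesAbove (fun t => -zeta a (φ t)) 0 t₁ η c := by
    refine decreasesAbove_of_absolutelyContinuous hac.neg ?_
    filter_upwards [hd] with t ht hmem
    obtain ⟨p, hp, -, hp2⟩ := ht hmem
    exact ⟨-p, hp.neg, fun hη => by linarith [hp2 (by linarith)]⟩
  intro t ht
  simpa using abs_le_max_of_decreasesAbove hcont hc hdec hdec' hZ t ht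

end IsPushedTrajectory

theorem mem_cube_of_extendZero {p : State m (s + 1)} {M : ℝ} (h1 : ‖p.1‖ ≤ M)
    (h2 : ∀ l ≤ s, |extendZero p.2 l| ≤ M) : p ∈ cube M := by
  refine ⟨fun i => (norm_le_pi_norm p.1 i).trans h1, fun i => ?_⟩
  have := h2 i (Nat.lt_succ_iff.1 i.2)
  rwa [extendZero_val] at this

theorem abs_extendZero_le {k : ℕ} {ξ : Fin k → ℝ} {R : ℝ} (hR : 0 ≤ R) (h : ∀ i, |ξ i| ≤ R)
    (l : ℕ) : |extendZero ξ l| ≤ R := by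
  unfold extendZero
  split_ifs
  · exact h _
  · simpa using hR

/-- The gain and, for each accuracy, the strength of a push that suffices. -/
theorem exists_gain_pushed (hf : LocallyLipschitz f) (hq : Continuous q) (hmin : IsMinimumPhase f)
    {R : ℝ} (hR : 0 < R) :
    ∃ a : Fin s → ℝ, AttractedFrom (reducedField f a) (cube R) ∧ ∃ Z > 0, ∀ ε > 0,
      ∃ η > 0, ∃ C > 0, ∃ T > 0, ∃ M : ℝ, ∀ (τ : EReal) (φ : ℝ → State m (s + 1)),
        IsPushedTrajectory f q a η C τ φ → φ 0 ∈ cube R → ∀ t : ℝ, 0 ≤ t → (t : EReal) < τ →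
          φ t ∈ cube M ∧ |zeta a (φ t)| ≤ Z ∧ (T ≤ t → φ t ∈ cube ε) := by
  obtain ⟨κ, hκ, t₀, ht₀, β, hβ, M₀, hM₀, hacc⟩ := exists_gain_chain hf hmin s hR
  obtain ⟨a, ha⟩ := exists_isGain s κ
  set Z : ℝ := (2 * κ) ^ s * R
  have hZ : 0 < Z := by positivity
  have hcubeR : ∀ {k : ℕ} {p : State m k}, p ∈ cube R → ‖p.1‖ ≤ R := fun hp =>
    (pi_norm_le_iff_of_nonneg hR.le).2 hp.1
  have hred : ∀ (x : ℝ → State m s) (t : ℝ),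
      shiftFilter κ s (fun l => extendZero (reducedLift a (x t)).2 l) 0 = 0 := fun x t => by
    rw [← zeta_reducedLift a (x t)]; exact (ha m _).symm
  have hredX : ∀ p : State m s, p ∈ cube R → ∀ l < s, |extendZero (reducedLift a p).2 l| ≤ R := by
    intro p hp l hl
    have hl1 : l < s + 1 := by omega
    rw [extendZero_of_lt _ hl1]
    have : (⟨l, hl1⟩ : Fin (s + 1)) = Fin.castSucc ⟨l, hl⟩ := rfl
    rw [this]
    simp only [reducedLift, Fin.snoc_castSucc]
    exact hp.2 ⟨l, hl⟩
  have hrednorm : ∀ (p : State m s) (M : ℝ), ‖p.1‖ ≤ M →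
      (∀ l ≤ s, |extendZero (reducedLift a p).2 l| ≤ M) → ‖p‖ ≤ M := by
    intro p M h1 h2
    have hM : 0 ≤ M := (norm_nonneg _).trans h1
    refine (mem_cube_iff hM).1 ⟨fun i => (norm_le_pi_norm p.1 i).trans h1, fun i => ?_⟩
    have h3 := h2 i i.2.le
    have hl1 : (i : ℕ) < s + 1 := by omega
    rw [extendZero_of_lt _ hl1] at h3
    have : (⟨i, hl1⟩ : Fin (s + 1)) = Fin.castSucc i := rfl
    rw [this] at h3
    simpa [reducedLift] using h3
  refine ⟨a, ⟨fun x₀ hx₀ => ?_, fun x hx hx0 => ?_⟩, Z, hZ, fun ε hε => ?_⟩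
  · refine exists_isForwardSolution_of_bound (locallyLipschitz_reducedField hf a) x₀ M₀
      fun x t₁ hx0 hxc hxd t ht => ?_
    rw [← hx0] at hx₀
    obtain ⟨h1, h2⟩ := reduced_isDrivenOn_isChainOn hxc hxd
    have := hM₀ _ _ t₁ h1 h2 (hcubeR hx₀) (hredX _ hx₀)
      (fun r _ => by rw [hred, abs_zero]; exact hZ.le)
      (fun r _ _ => by rw [hred, abs_zero]; exact hβ.le) t ht
    exact hrednorm _ _ this.1 this.2
  · rw [Metric.tendsto_atTop]
    intro ε hε
    obtain ⟨β', hβ', T, hT, hlim⟩ := hacc (ε / 2) (by positivity)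
    refine ⟨T, fun t ht => ?_⟩
    obtain ⟨h1, h2⟩ := reduced_isDrivenOn_isChainOn (b := t)
      (hx.continuousOn.mono Icc_subset_Ici_self) fun r hr => hx.hasDerivWithinAt_Ici hr.1
    have := hlim _ _ t h1 h2 (hcubeR hx0) (hredX _ hx0)
      (fun r _ => by rw [hred, abs_zero]; exact hZ.le)
      (fun r _ _ => by rw [hred, abs_zero]; exact (lt_min hβ hβ').le) t ⟨by linarith, le_rfl⟩ ht
    rw [dist_zero_right]
    have := hrednorm _ _ this.1 this.2
    linarith
  · obtain ⟨β', hβ', T, hT, hlim⟩ := hacc ε hε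
    -- Bounding `η` by `Z` ensures that the dead zone does not spoil the estimate `|ζ| ≤ Z`.
    set η : ℝ := min (min β β') Z
    have hη : 0 < η := by positivity
    set M : ℝ := max M₀ R
    obtain ⟨L, hL0, hL⟩ := exists_norm_le_of_isCompact
      (f := fun p : State m (s + 1) => |∑ i, a i * p.2 i.succ| + |q p| + 1) (by fun_prop)
      (isCompact_closedBall (0 : State m (s + 1)) (M + 1))
    -- `L` pays for the drift in the ball of radius `M + 1`; the surplus `Z / t₀` brings `|ζ|` from
    -- `Z` into the dead zone by time `t₀`.
    refine ⟨η, hη, L + Z / t₀, by positivity, T, hT, M, fun τ φ hφ hφ0 t ht htτ => ?_⟩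
    have hX0 : ∀ l, |extendZero (φ 0).2 l| ≤ R := abs_extendZero_le hR.le hφ0.2
    have hζ : ∀ p : State m (s + 1), shiftFilter κ s (fun l => extendZero p.2 l) 0 = zeta a p :=
      fun p => (ha m p).symm
    have hζ0 : |zeta a (φ 0)| ≤ Z := by
      rw [← hζ]
      exact abs_shiftFilter_le (n := s) hκ hR.le (fun l _ => hX0 l) s 0 le_rfl
    -- Estimates up to a time until which the trajectory stays in the ball of radius `M + 1`.
    have hest : ∀ t₁ ∈ Icc 0 t, (∀ r ∈ Icc 0 t₁, ‖φ r‖ ≤ M + 1) →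
        φ t₁ ∈ cube M ∧ |zeta a (φ t₁)| ≤ Z ∧ (T ≤ t₁ → φ t₁ ∈ cube ε) := by
      intro t₁ ht₁ hle
      have hτ : (t₁ : EReal) < τ := (EReal.coe_le_coe_iff.2 ht₁.2).trans_lt htτ
      have hz := hφ.abs_zeta_le (Z := Z) (c := Z / t₀) (L := L) ht₁.1 hτ (by positivity) le_rfl
        (fun r hr => (le_abs_self _).trans (hL _ (by simpa using hle r hr))) hζ0
      have hzZ : ∀ r ∈ Icc 0 t₁, |zeta a (φ r)| ≤ Z := fun r hr => by
        refine (hz r hr).trans (max_le (min_le_right _ _) ?_)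
        have : 0 ≤ Z / t₀ * r := mul_nonneg (by positivity) hr.1
        linarith
      have hzη : ∀ r ∈ Icc 0 t₁, t₀ ≤ r → |zeta a (φ r)| ≤ η := fun r hr hr0 => by
        refine (hz r hr).trans (max_le le_rfl ?_)
        have : Z / t₀ * t₀ ≤ Z / t₀ * r := mul_le_mul_of_nonneg_left hr0 (by positivity)
        rw [div_mul_cancel₀ _ ht₀.ne'] at this
        linarith
      obtain ⟨h1, h2⟩ := hφ.isDrivenOn_isChainOn hf.continuous ht₁.1 hτ
      have hA := hM₀ _ _ t₁ h1 h2 (hcubeR hφ0) (fun l _ => hX0 l)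
        (fun r hr => by rw [hζ]; exact hzZ r hr)
        (fun r hr hr0 => by
          rw [hζ]; exact (hzη r hr hr0).trans ((min_le_left _ _).trans (min_le_left _ _)))
        t₁ ⟨ht₁.1, le_rfl⟩
      have hB := hlim _ _ t₁ h1 h2 (hcubeR hφ0) (fun l _ => hX0 l)
        (fun r hr => by rw [hζ]; exact hzZ r hr)
        (fun r hr hr0 => by rw [hζ]; exact (hzη r hr hr0).trans (min_le_left _ _))
        t₁ ⟨ht₁.1, le_rfl⟩
      exact ⟨mem_cube_of_extendZero (hA.1.trans (le_max_left _ _))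
        fun l hl => (hA.2 l hl).trans (le_max_left _ _), hzZ t₁ ⟨ht₁.1, le_rfl⟩,
        fun hT1 => mem_cube_of_extendZero (hB hT1).1 (hB hT1).2⟩
    have hM0 : 0 ≤ M := hR.le.trans (le_max_right _ _)
    -- As long as the ball of radius `M + 1` is not left, the estimates confine the state to radius
    -- `M`; so it is never left.
    have htrap := lt_of_forall_le_imp_lt (g := fun t => ‖φ t‖) (e := M + 1)
      (hφ.continuousOn ht htτ).norm
      (fun _ => by
        have h1 := (mem_cube_iff hR.le).1 hφ0
        have h2 : R ≤ M := le_max_right _ _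
        linarith)
      (fun t₁ ht₁ hle => by
        have := (mem_cube_iff hM0).1 (hest t₁ ht₁ hle).1
        linarith)
    exact hest t ⟨ht, le_rfl⟩ fun r hr => (htrap r hr).le

end QuantizedControl

namespace QuantizedControl

/-! ### Quantization levels and sector bounds -/

section Levels

variable {δ u₀ : ℝ} {j : ℕ}

theorem level_zero (δ u₀ : ℝ) : level δ u₀ 0 = u₀ := by simp [level]

theorem level_pos (hδ : 0 < δ) (hδ1 : δ < 1) (hu : 0 < u₀) (i : ℕ) : 0 < level δ u₀ i := by
  have : 0 < 1 - δ := by linarith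
  unfold level; positivity

theorem level_succ (hδ : 0 < δ) (i : ℕ) :
    level δ u₀ (i + 1) = (1 - δ) * (level δ u₀ i / (1 + δ)) := by
  have : 1 + δ ≠ 0 := by positivity
  unfold level; rw [pow_succ]; field_simp

/-- Consecutive quantization intervals abut, without gap or overlap. -/
theorem level_succ_div (hδ : 0 < δ) (hδ1 : δ < 1) (i : ℕ) :
    level δ u₀ (i + 1) / (1 - δ) = level δ u₀ i / (1 + δ) := by
  have : 1 - δ ≠ 0 := by linarith
  rw [level_succ hδ]; field_simp

theorem exists_level_lt (hδ : 0 < δ) (hδ1 : δ < 1) (hu : 0 < u₀) {v : ℝ} (hv : 0 < v) :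
    ∃ j, level δ u₀ j / (1 + δ) < v := by
  have h1 : (1 - δ) / (1 + δ) < 1 := by rw [div_lt_one (by linarith)]; linarith
  obtain ⟨j, hj⟩ := exists_pow_lt_of_lt_one (div_pos hv hu) h1
  refine ⟨j, ?_⟩
  have h2 : level δ u₀ j < v := by
    rw [lt_div_iff₀ hu] at hj; exact hj
  have h3 := level_pos hδ hδ1 hu j
  exact (div_le_self h3.le (by linarith)).trans_lt h2

/-- On the `i`-th interval the upper end gives `(1 - δ) r ≤ uᵢ`. The minimum with `u₀` makes the
bound hold beyond the range as well, so the range condition can be deduced afterwards from `|ζ| ≤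
Z`. -/
theorem le_quantizerPos (hδ1 : δ < 1) {r : ℝ} (hr : level δ u₀ j / (1 + δ) < r) :
    min ((1 - δ) * r) u₀ ≤ quantizerPos δ u₀ j r := by
  unfold quantizerPos
  split_ifs with h1 h2
  · have := h1.choose_spec.2.2
    rw [le_div_iff₀ (by linarith)] at this
    exact (min_le_left _ _).trans (by linarith)
  · exact absurd h2 (not_le.2 hr)
  · exact min_le_right _ _

theorem le_quantizer (hδ : 0 < δ) (hδ1 : δ < 1) (hu : 0 < u₀) {r : ℝ}
    (hr : level δ u₀ j / (1 + δ) < r) : min ((1 - δ) * r) u₀ ≤ quantizer δ u₀ j r := by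
  have h1 := level_pos hδ hδ1 hu j
  have h2 : 0 < level δ u₀ j / (1 + δ) := by positivity
  rw [quantizer, if_pos (by linarith)]
  exact le_quantizerPos hδ1 hr

theorem quantizer_neg_of_pos {r : ℝ} (hr : 0 < r) :
    quantizer δ u₀ j (-r) = -quantizer δ u₀ j r := by
  rw [quantizer, if_neg (by linarith), quantizer, if_pos hr.le, neg_neg]

end Levels

/-! ### Krasowskii solutions -/

section Krasowskii

variable {E : Type*} [NormedAddCommGroup E] [NormedSpace ℝ E]

/-- A closed half-space is closed and convex, so it survives the regularization. -/
theorem le_of_mem_krasowskii {G : E → E} {x v : E} (hv : v ∈ krasowskii G x) (l : E →L[ℝ] ℝ)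
    {c : ℝ} (h : ∀ᶠ y in 𝓝 x, l (G y) ≤ c) : l v ≤ c := by
  obtain ⟨ρ, hρ, hball⟩ := Metric.eventually_nhds_iff_ball.1 h
  have h1 : v ∈ closure (convexHull ℝ (G '' Metric.ball x ρ)) := mem_iInter₂.1 hv ρ hρ
  have h2 : closure (convexHull ℝ (G '' Metric.ball x ρ)) ⊆ {w | l w ≤ c} := by
    refine closure_minimal (convexHull_min ?_ (convex_halfSpace_le l.isLinear c))
      (isClosed_le l.continuous continuous_const)
    rintro _ ⟨y, hy, rfl⟩
    exact hball y hy
  exact h2 h1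

theorem eq_of_mem_krasowskii {G : E → E} {x v : E} (hv : v ∈ krasowskii G x) (l : E →L[ℝ] ℝ)
    {h : E → ℝ} (hh : ContinuousAt h x) (hG : ∀ y, l (G y) = h y) : l v = h x := by
  refine le_antisymm (le_of_forall_pos_le_add fun e he => ?_)
    (le_of_forall_pos_le_add fun e he => ?_)
  · refine le_of_mem_krasowskii hv l ?_
    filter_upwards [hh.eventually (gt_mem_nhds (by linarith : h x < h x + e))] with y hy
    rw [hG]; exact hy.le
  · have := le_of_mem_krasowskii hv (-l) (c := -h x + e) (by
      filter_upwards [hh.eventually (lt_mem_nhds (by linarith : h x - e < h x))] with y hy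
      rw [neg_apply, hG]; linarith)
    rw [neg_apply] at this
    linarith

end Krasowskii

section Closed

variable {m s : ℕ} {f : (Fin m → ℝ) × ℝ → (Fin m → ℝ)} {q b : State m (s + 1) → ℝ} {a : Fin s → ℝ}

/-- All components but the last are continuous in the state, and regularization leaves a continuous
component single-valued. -/
theorem eq_velocity_of_mem_krasowskii (hf : Continuous f) {u : State m (s + 1) → ℝ}
    {x v : State m (s + 1)} (hv : v ∈ krasowskii (fun p => normalForm f q b p (u p)) x) :
    v = velocity f x (v.2 (Fin.last s)) := by
  refine Prod.ext (funext fun i => ?_) (funext fun i => ?_)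
  · exact eq_of_mem_krasowskii hv
      ((ContinuousLinearMap.proj i).comp (ContinuousLinearMap.fst ℝ (Fin m → ℝ) (Fin (s + 1) → ℝ)))
      (h := fun p => f (p.1, p.2 0) i) (by fun_prop) fun y => rfl
  · refine Fin.lastCases ?_ (fun i => ?_) i
    · simp [velocity]
    · have := eq_of_mem_krasowskii hv ((ContinuousLinearMap.proj i.castSucc).comp
        (ContinuousLinearMap.snd ℝ (Fin m → ℝ) (Fin (s + 1) → ℝ)))
        (h := fun p => p.2 i.succ) (by fun_prop) fun y => by simp [normalForm]
      simpa [velocity] using this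

/-- The regularization sees neighbouring states. If `ζ > η` at a point, then `ζ > η / 2` nearby,
whence the threshold `k * η / 2`; the variation of `q` is absorbed by the `1` in the definition of a
push. -/
theorem IsQuantizedTrajectory.isPushedTrajectory (hf : Continuous f) (hq : Continuous q)
    {b₀ : ℝ} (hb₀ : 0 < b₀) (hb : ∀ p, b₀ ≤ b p) {δ u₀ k η C : ℝ} {j : ℕ} (hk : 0 < k)
    (hη : 0 < η) (hC : 0 ≤ C)
    (hΨ : ∀ v, k * η / 2 < v → C / b₀ ≤ quantizer δ u₀ j v) {τ : EReal} {φ : ℝ → State m (s + 1)}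
    (h : IsQuantizedTrajectory f q b a δ u₀ j k τ φ) : IsPushedTrajectory f q a η C τ φ := by
  refine ⟨h.absCont, ?_⟩
  filter_upwards [h.inclusion] with t ht h0 hτ
  obtain ⟨v, hv, hd⟩ := ht h0 hτ
  set l : State m (s + 1) →L[ℝ] ℝ := (ContinuousLinearMap.proj (Fin.last s)).comp
    (ContinuousLinearMap.snd ℝ (Fin m → ℝ) (Fin (s + 1) → ℝ))
  have hl : ∀ p c, l (normalForm f q b p c) = q p + b p * c := fun p c => by
    simp [l, normalForm]
  have hlv : l v = v.2 (Fin.last s) := rfl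
  have hqc := (hq.tendsto (φ t))
  have hζc : ContinuousAt (zeta (m := m) a) (φ t) := (continuous_zeta a).continuousAt
  have hkη : 0 < k * η := by positivity
  have hbC : ∀ (p : State m (s + 1)) (w : ℝ), C / b₀ ≤ w → C ≤ b p * w := fun p w hw => by
    rw [div_le_iff₀ hb₀] at hw
    have hw0 : 0 ≤ w := by
      by_contra! hneg
      nlinarith
    nlinarith [hb p]
  refine ⟨v.2 (Fin.last s), ?_, fun hlt => ?_, fun hlt => ?_⟩
  · rw [← eq_velocity_of_mem_krasowskii hf hv]; exact hd
  · rw [← hlv]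
    refine le_of_mem_krasowskii hv l ?_
    filter_upwards [hqc.eventually (gt_mem_nhds (lt_add_one _)),
      hζc.eventually (lt_mem_nhds (show η / 2 < _ by linarith))] with p hp1 hp2
    rw [hl]
    have h1 := hbC p _ (hΨ (k * zeta a p) (by nlinarith))
    linarith
  · rw [← hlv]
    have := le_of_mem_krasowskii hv (-l) (c := -(q (φ t) - 1 + C)) (by
      filter_upwards [hqc.eventually (lt_mem_nhds (sub_one_lt _)),
        hζc.eventually (gt_mem_nhds (show _ < -(η / 2) by linarith))] with p hp1 hp2
      rw [neg_apply, hl]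
      have h2 : k * η / 2 < k * -zeta a p := by nlinarith
      have h1 := hbC p _ (hΨ (k * -zeta a p) h2)
      have h3 : quantizer δ u₀ j (k * zeta a p) = -quantizer δ u₀ j (k * -zeta a p) := by
        rw [← quantizer_neg_of_pos (by linarith)]; ring_nf
      rw [h3]
      linarith)
    rw [neg_apply] at this
    linarith

end Closed

/-! ### Switched trajectories -/

section Switched

variable {E : Type*} [NormedAddCommGroup E] [NormedSpace ℝ E]

namespace IsSwitchedTrajectory

variable {g : E → ℝ → E} {y : E → ℝ} {w₀ : ℝ → ℝ} {next : ℝ → ℝ → ℝ → Prop} {τ : EReal}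
  {φ : ℝ → E} {w : ℝ → ℝ}

theorem continuousOn (h : IsSwitchedTrajectory g y w₀ next τ φ w) {t : ℝ} (h0 : 0 ≤ t)
    (h1 : (t : EReal) < τ) : ContinuousOn φ (Icc 0 t) := by
  have := (h.absCont t h0 h1).continuousOn
  rwa [uIcc_of_le h0] at this

theorem tendsto_left (h : IsSwitchedTrajectory g y w₀ next τ φ w) {t : ℝ} (h0 : 0 < t)
    (h1 : (t : EReal) < τ) : Tendsto φ (𝓝[<] t) (𝓝 (φ t)) := by
  rw [← nhdsWithin_Ico_eq_nhdsLT h0]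
  exact (h.continuousOn h0.le h1 t ⟨h0.le, le_rfl⟩).mono_left (nhdsWithin_mono _ Ico_subset_Icc_self)

/-- The value of the signal is a successor of itself for measurements shortly before. -/
theorem exists_next_self (h : IsSwitchedTrajectory g y w₀ next τ φ w) {t : ℝ} (h0 : 0 < t)
    (h1 : (t : EReal) < τ) {Q : ℝ → Prop} (hQ : ∀ᶠ r in 𝓝[<] t, Q r) :
    ∃ r, Q r ∧ next (w t) (y (φ r)) (w t) := by
  have hleft := h.left t h0 h1
  obtain ⟨l, hl, hlw⟩ := (mem_nhdsLT_iff_exists_Ioo_subset' h0).1 hleft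
  have hmem : Ioo (max l 0) t ∈ 𝓝[<] t := Ioo_mem_nhdsLT (max_lt hl h0)
  obtain ⟨r, hrQ, hr⟩ := (hQ.and hmem).exists
  have hr0 : 0 < r := (le_max_right _ _).trans_lt hr.1
  have hlr : l < r := (le_max_left _ _).trans_lt hr.1
  -- The signal is constant shortly before `t`, so at such an `r` its right limit is again `w t`.
  obtain ⟨w', hw', hev⟩ := h.right r hr0.le ((EReal.coe_lt_coe_iff.2 hr.2).trans h1)
  have hev' : ∀ᶠ r' in 𝓝[>] r, w r' = w t := by
    filter_upwards [Ioo_mem_nhdsGT hr.2] with r' hr'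
    exact hlw ⟨hlr.trans hr'.1, hr'.2⟩
  obtain ⟨r', h2, h3⟩ := (hev.and hev').exists
  have hwr : w r = w t := hlw ⟨hlr, hr.2⟩
  rw [h2] at h3
  rw [hwr, h3] at hw'
  exact ⟨r, hrQ, hw'⟩

end IsSwitchedTrajectory

end Switched

section Closed

variable {m s : ℕ} {f : (Fin m → ℝ) × ℝ → (Fin m → ℝ)} {q b : State m (s + 1) → ℝ} {a : Fin s → ℝ}

theorem eq_neg_of_ternaryNext {k η u ζ : ℝ} (hη : 0 < η) (hζ : η < ζ)
    (h : u = ternaryNext k η u ζ) : u = -k := by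
  unfold ternaryNext at h
  split_ifs at h with h1 h2
  · exact h
  · rcases h2 with ⟨-, h2⟩ | ⟨-, h2⟩ <;> linarith
  · exact absurd (Or.inl ⟨h, hζ.le⟩) h1

theorem eq_of_ternaryNext {k η u ζ : ℝ} (hη : 0 < η) (hζ : ζ < -η)
    (h : u = ternaryNext k η u ζ) : u = k := by
  unfold ternaryNext at h
  split_ifs at h with h1 h2
  · rcases h1 with ⟨-, h1⟩ | ⟨-, h1⟩ <;> linarith
  · exact h
  · exact absurd (Or.inl ⟨h, hζ.le⟩) h2

/-- If `ζ(t)` is outside the dead zone, so is `ζ` shortly before `t`. There `u(t)` must be its own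
successor, which leaves only the value of the correct sign. -/
theorem IsTernaryTrajectory.isPushedTrajectory {b₀ : ℝ} (hb₀ : 0 < b₀) (hb : ∀ p, b₀ ≤ b p)
    {η C : ℝ} (hη : 0 < η) (hC : 0 < C) {τ : EReal} {φ : ℝ → State m (s + 1)}
    (h : IsTernaryTrajectory f q b a (C / b₀) η τ φ) : IsPushedTrajectory f q a η C τ φ := by
  obtain ⟨w, h⟩ := h
  have hk : 0 < C / b₀ := by positivity
  refine ⟨h.absCont, ?_⟩
  filter_upwards [h.ode] with t ht h0 hτ
  have hbk : C ≤ b (φ t) * (C / b₀) := by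
    have := mul_le_mul_of_nonneg_right (hb (φ t)) hk.le
    rwa [mul_div_cancel₀ _ hb₀.ne'] at this
  have hζ : Tendsto (fun r => zeta a (φ r)) (𝓝[<] t) (𝓝 (zeta a (φ t))) :=
    ((continuous_zeta a).tendsto _).comp (h.tendsto_left h0 hτ)
  refine ⟨_, ht h0 hτ, fun hlt => ?_, fun hlt => ?_⟩
  · obtain ⟨r, hr, hnext⟩ := h.exists_next_self h0 hτ (hζ.eventually (lt_mem_nhds hlt))
    rw [eq_neg_of_ternaryNext hη hr hnext]
    linarith
  · obtain ⟨r, hr, hnext⟩ := h.exists_next_self h0 hτ (hζ.eventually (gt_mem_nhds hlt))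
    rw [eq_of_ternaryNext hη hr hnext]
    linarith

end Closed

/-! ### The quantizer with hysteresis -/

/-- The inputs `r` compatible with a positive value `v` of `Ψ_m`; `le` is `≤` or `<`. -/
def HysteresisPos (le : ℝ → ℝ → Prop) (δ u₀ : ℝ) (j : ℕ) (v r : ℝ) : Prop :=
  (∃ i ≤ j, v = level δ u₀ i ∧ le (level δ u₀ i / (1 + δ)) r ∧
    (0 < i → le r (level δ u₀ i / (1 - δ)))) ∨
  ∃ i ≤ j, v = level δ u₀ i / (1 + δ) ∧ le (level δ u₀ i / (1 + δ) ^ 2) r ∧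
    le r (level δ u₀ i / (1 - δ ^ 2))

/-- The inputs `r` compatible with the value `v` of `Ψ_m`; `le` is `≤` or `<`. -/
def HysteresisRegion (le : ℝ → ℝ → Prop) (δ u₀ : ℝ) (j : ℕ) (v r : ℝ) : Prop :=
  HysteresisPos le δ u₀ j v r ∨ HysteresisPos le δ u₀ j (-v) (-r) ∨
    v = 0 ∧ le (-(level δ u₀ j / (1 + δ))) r ∧ le r (level δ u₀ j / (1 + δ))

section Hysteresis

variable {δ u₀ : ℝ} {j : ℕ}

theorem HysteresisPos.mono {v r : ℝ} (h : HysteresisPos (· < ·) δ u₀ j v r) :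
    HysteresisPos (· ≤ ·) δ u₀ j v r := by
  rcases h with ⟨i, hi, hv, h1, h2⟩ | ⟨i, hi, hv, h1, h2⟩
  · exact Or.inl ⟨i, hi, hv, le_of_lt h1, fun h => (h2 h).le⟩
  · exact Or.inr ⟨i, hi, hv, le_of_lt h1, le_of_lt h2⟩

theorem HysteresisRegion.mono {v r : ℝ} (h : HysteresisRegion (· < ·) δ u₀ j v r) :
    HysteresisRegion (· ≤ ·) δ u₀ j v r := by
  rcases h with h | h | ⟨hv, h1, h2⟩
  · exact Or.inl h.mono
  · exact Or.inr (Or.inl h.mono)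
  · exact Or.inr (Or.inr ⟨hv, le_of_lt h1, le_of_lt h2⟩)

theorem HysteresisRegion.neg {v r : ℝ} {le : ℝ → ℝ → Prop}
    (hle : ∀ x y, le x y → le (-y) (-x)) (h : HysteresisRegion le δ u₀ j v r) :
    HysteresisRegion le δ u₀ j (-v) (-r) := by
  rcases h with h | h | ⟨hv, h1, h2⟩
  · exact Or.inr (Or.inl (by rwa [neg_neg, neg_neg]))
  · exact Or.inl h
  · exact Or.inr (Or.inr ⟨by simp [hv], hle _ _ h2, by simpa using hle _ _ h1⟩)

/-- After a transition the input lies in the interior of the new region. -/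
theorem HysteresisEdge.hysteresisRegion (hδ : 0 < δ) (hδ1 : δ < 1) (hu : 0 < u₀) {v r v' : ℝ}
    (h : HysteresisEdge δ u₀ j v r v') : HysteresisRegion (· < ·) δ u₀ j v' r := by
  have hp : 0 < 1 + δ := by linarith
  have hn : 0 < 1 - δ := by linarith
  have hpn : 0 < 1 - δ ^ 2 := by nlinarith
  have hL := level_pos hδ hδ1 hu
  have hmid : ∀ i ≤ j, HysteresisRegion (· < ·) δ u₀ j (level δ u₀ i / (1 + δ))
      (level δ u₀ i / (1 + δ)) := fun i hi =>
    Or.inl (Or.inr ⟨i, hi, rfl, div_lt_div_of_pos_left (hL i) hp (by nlinarith),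
      div_lt_div_of_pos_left (hL i) hpn (by nlinarith)⟩)
  induction h with
  | level_down i hi => exact hmid i hi
  | mid_up i hi =>
    exact Or.inl (Or.inl ⟨i, hi, rfl, div_lt_div_of_pos_left (hL i) hpn (by nlinarith),
      fun _ => div_lt_div_of_pos_left (hL i) hn (by nlinarith)⟩)
  | mid_down i hi =>
    refine Or.inl (Or.inl ⟨i + 1, hi, rfl, ?_, fun _ => ?_⟩)
    · show level δ u₀ (i + 1) / (1 + δ) < level δ u₀ i / (1 + δ) ^ 2
      rw [level_succ hδ, div_lt_div_iff₀ hp (by positivity)]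
      have h1 : (1 - δ) * (level δ u₀ i / (1 + δ)) * (1 + δ) ^ 2
          = (1 - δ) * (level δ u₀ i * (1 + δ)) := by field_simp
      rw [h1]
      nlinarith [mul_pos (hL i) hp]
    · show level δ u₀ i / (1 + δ) ^ 2 < level δ u₀ (i + 1) / (1 - δ)
      rw [level_succ_div hδ hδ1]
      exact div_lt_div_of_pos_left (hL i) hp (by nlinarith)
  | level_up i hi => exact hmid i hi.le
  | to_zero =>
    refine Or.inr (Or.inr ⟨rfl, ?_, div_lt_div_of_pos_left (hL j) hp (by nlinarith)⟩)
    have h1 : 0 < level δ u₀ j / (1 + δ) := div_pos (hL j) hp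
    have h2 : 0 < level δ u₀ j / (1 + δ) ^ 2 := div_pos (hL j) (by positivity)
    show -(level δ u₀ j / (1 + δ)) < level δ u₀ j / (1 + δ) ^ 2
    linarith
  | from_zero => exact hmid j le_rfl
  | neg _ ih => exact ih.neg fun _ _ h => neg_lt_neg h

/-- Every end point of a region is the guard of an edge leaving that value. The top level `u₀` has
no upper end point, so inputs beyond the range are allowed. -/
theorem HysteresisPos.strict (hδ : 0 < δ) (hδ1 : δ < 1) {v r : ℝ}
    (h : HysteresisPos (· ≤ ·) δ u₀ j v r) (hno : ¬ ∃ v', HysteresisEdge δ u₀ j v r v') :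
    HysteresisPos (· < ·) δ u₀ j v r := by
  rcases h with ⟨i, hi, rfl, h1, h2⟩ | ⟨i, hi, rfl, h1, h2⟩
  · refine Or.inl ⟨i, hi, rfl, lt_of_le_of_ne h1 fun h => ?_, fun h0 =>
      lt_of_le_of_ne (h2 h0) fun h => ?_⟩
    · exact hno ⟨_, h ▸ HysteresisEdge.level_down i hi⟩
    · obtain ⟨i, rfl⟩ := Nat.exists_eq_succ_of_ne_zero h0.ne'
      rw [Nat.succ_eq_add_one, level_succ_div hδ hδ1] at h
      exact hno ⟨_, h ▸ HysteresisEdge.level_up i hi⟩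
  · refine Or.inr ⟨i, hi, rfl, lt_of_le_of_ne h1 fun h => ?_, lt_of_le_of_ne h2 fun h => ?_⟩
    · rcases hi.lt_or_eq with hlt | rfl
      · exact hno ⟨_, h ▸ HysteresisEdge.mid_down i hlt⟩
      · exact hno ⟨_, h ▸ HysteresisEdge.to_zero⟩
    · exact hno ⟨_, h ▸ HysteresisEdge.mid_up i hi⟩

/-- If no transition is possible, the input lies in the interior of the region. -/
theorem HysteresisRegion.strict (hδ : 0 < δ) (hδ1 : δ < 1) {v r : ℝ}
    (h : HysteresisRegion (· ≤ ·) δ u₀ j v r) (hno : ¬ ∃ v', HysteresisEdge δ u₀ j v r v') :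
    HysteresisRegion (· < ·) δ u₀ j v r := by
  rcases h with h | h | ⟨rfl, h1, h2⟩
  · exact Or.inl (h.strict hδ hδ1 hno)
  · refine Or.inr (Or.inl (h.strict hδ hδ1 fun ⟨v', he⟩ => hno ⟨-v', ?_⟩))
    simpa using he.neg
  · refine Or.inr (Or.inr ⟨rfl, lt_of_le_of_ne h1 fun h => ?_, lt_of_le_of_ne h2 fun h => ?_⟩)
    · have := (HysteresisEdge.from_zero (δ := δ) (u₀ := u₀) (j := j)).neg
      rw [neg_zero, h] at this
      exact hno ⟨_, this⟩
    · exact hno ⟨_, h ▸ HysteresisEdge.from_zero⟩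

/-- An update turns membership in the closed region into membership in the open one, which then
persists to the right by continuity. -/
theorem hysteresisNext.hysteresisRegion (hδ : 0 < δ) (hδ1 : δ < 1) (hu : 0 < u₀) {v r v' : ℝ}
    (h : hysteresisNext δ u₀ j v r v') (hv : HysteresisRegion (· ≤ ·) δ u₀ j v r) :
    HysteresisRegion (· < ·) δ u₀ j v' r := by
  rcases h with h | ⟨hno, rfl⟩
  · exact h.hysteresisRegion hδ hδ1 hu
  · exact hv.strict hδ hδ1 hno

theorem HysteresisPos.eventually {v r : ℝ} (h : HysteresisPos (· < ·) δ u₀ j v r) :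
    ∀ᶠ r' in 𝓝 r, HysteresisPos (· < ·) δ u₀ j v r' := by
  rcases h with ⟨i, hi, hv, h1, h2⟩ | ⟨i, hi, hv, h1, h2⟩
  · have h3 : ∀ᶠ r' in 𝓝 r, 0 < i → r' < level δ u₀ i / (1 - δ) := by
      rcases Nat.eq_zero_or_pos i with rfl | h0
      · exact Eventually.of_forall fun _ h => absurd h (lt_irrefl _)
      · exact (gt_mem_nhds (h2 h0)).mono fun _ h _ => h
    filter_upwards [lt_mem_nhds h1, h3] with r' h4 h5
    exact Or.inl ⟨i, hi, hv, h4, h5⟩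
  · filter_upwards [lt_mem_nhds h1, gt_mem_nhds h2] with r' h4 h5
    exact Or.inr ⟨i, hi, hv, h4, h5⟩

theorem HysteresisRegion.eventually {v r : ℝ} (h : HysteresisRegion (· < ·) δ u₀ j v r) :
    ∀ᶠ r' in 𝓝 r, HysteresisRegion (· < ·) δ u₀ j v r' := by
  rcases h with h | h | ⟨hv, h1, h2⟩
  · exact h.eventually.mono fun _ h => Or.inl h
  · exact ((continuous_neg.tendsto r).eventually h.eventually).mono fun _ h => Or.inr (Or.inl h)
  · filter_upwards [lt_mem_nhds h1, gt_mem_nhds h2] with r' h4 h5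
    exact Or.inr (Or.inr ⟨hv, h4, h5⟩)

theorem isClosed_hysteresisPos (v : ℝ) : IsClosed {r | HysteresisPos (· ≤ ·) δ u₀ j v r} := by
  have h1 : {r | HysteresisPos (· ≤ ·) δ u₀ j v r} =
      (⋃ i ∈ Iic j, {r | v = level δ u₀ i ∧ level δ u₀ i / (1 + δ) ≤ r ∧
        (0 < i → r ≤ level δ u₀ i / (1 - δ))}) ∪
      ⋃ i ∈ Iic j, {r | v = level δ u₀ i / (1 + δ) ∧ level δ u₀ i / (1 + δ) ^ 2 ≤ r ∧
        r ≤ level δ u₀ i / (1 - δ ^ 2)} := by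
    ext r
    simp only [HysteresisPos, mem_ofPred_eq, mem_union, mem_iUnion, mem_Iic, exists_prop]
  rw [h1]
  refine IsClosed.union ((finite_Iic j).isClosed_biUnion fun i _ => ?_)
    ((finite_Iic j).isClosed_biUnion fun i _ => ?_)
  · have h2 : IsClosed {r : ℝ | 0 < i → r ≤ level δ u₀ i / (1 - δ)} := by
      by_cases h : 0 < i
      · simpa only [h, forall_const] using isClosed_le continuous_id' continuous_const
      · simp [h]
    exact isClosed_const.and ((isClosed_le continuous_const continuous_id).and h2)
  · exact isClosed_const.and ((isClosed_le continuous_const continuous_id).and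
      (isClosed_le continuous_id continuous_const))

theorem isClosed_hysteresisRegion (v : ℝ) :
    IsClosed {r | HysteresisRegion (· ≤ ·) δ u₀ j v r} := by
  have h2 : IsClosed {r : ℝ | HysteresisPos (· ≤ ·) δ u₀ j (-v) (-r)} :=
    (isClosed_hysteresisPos (-v)).preimage continuous_neg
  exact (isClosed_hysteresisPos v).union (h2.union (isClosed_const.and
    ((isClosed_le continuous_const continuous_id).and
      (isClosed_le continuous_id continuous_const))))

theorem HysteresisPos.pos (hδ : 0 < δ) (hδ1 : δ < 1) (hu : 0 < u₀) {v r : ℝ}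
    (h : HysteresisPos (· ≤ ·) δ u₀ j v r) : 0 < r := by
  rcases h with ⟨i, -, -, h1, -⟩ | ⟨i, -, -, h1, -⟩
  · exact (div_pos (level_pos hδ hδ1 hu i) (by linarith)).trans_le h1
  · exact (div_pos (level_pos hδ hδ1 hu i) (by positivity)).trans_le h1

/-- For an intermediate value, `r ≤ uᵢ / (1 - δ²)` means `(1 - δ) r ≤ uᵢ / (1 + δ)`: hysteresis
obeys the same lower sector bound as the plain quantizer. -/
theorem HysteresisRegion.le_value (hδ : 0 < δ) (hδ1 : δ < 1) (hu : 0 < u₀) {v r : ℝ}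
    (h : HysteresisRegion (· ≤ ·) δ u₀ j v r) (hr : level δ u₀ j / (1 + δ) < r) :
    min ((1 - δ) * r) u₀ ≤ v := by
  have hn : 0 < 1 - δ := by linarith
  have hp : 0 < 1 + δ := by linarith
  have hr0 : 0 < r := (div_pos (level_pos hδ hδ1 hu j) hp).trans hr
  rcases h with (⟨i, -, rfl, h1, h2⟩ | ⟨i, -, rfl, h1, h2⟩) | h | ⟨-, -, h2⟩
  · rcases Nat.eq_zero_or_pos i with rfl | h0
    · rw [level_zero]; exact min_le_right _ _
    · have : r ≤ level δ u₀ i / (1 - δ) := h2 h0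
      rw [le_div_iff₀ hn] at this
      exact (min_le_left _ _).trans (by linarith)
  · refine (min_le_left _ _).trans ?_
    rw [le_div_iff₀ (by nlinarith)] at h2
    rw [le_div_iff₀ hp]
    linarith
  · linarith [h.pos hδ hδ1 hu]
  · exact absurd h2 (not_le.2 hr)

/-- The initial value of `Ψ_m` is compatible with the input. -/
theorem hysteresisRegion_quantizer (hδ : 0 < δ) (hδ1 : δ < 1) (r : ℝ) :
    HysteresisRegion (· ≤ ·) δ u₀ j (quantizer δ u₀ j r) r := by
  have hn : 0 < 1 - δ := by linarith
  have hp : 0 < 1 + δ := by linarith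
  have key : ∀ r, 0 ≤ r → HysteresisPos (· ≤ ·) δ u₀ j (quantizerPos δ u₀ j r) r ∨
      quantizerPos δ u₀ j r = 0 ∧ r ≤ level δ u₀ j / (1 + δ) := by
    intro r hr
    unfold quantizerPos
    split_ifs with h1 h2
    · exact Or.inl (Or.inl ⟨h1.choose, h1.choose_spec.1, rfl, h1.choose_spec.2.1.le,
        fun _ => h1.choose_spec.2.2⟩)
    · exact Or.inr ⟨rfl, h2⟩
    -- An input above the dead zone and in no interval lies above all of them: exceeding the lower
    -- end of one and not belonging to it means exceeding its upper end, which is the lower end of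
    -- the next larger one.
    · have h3 : ∀ i ≤ j, level δ u₀ i / (1 + δ) < r → level δ u₀ 0 / (1 + δ) < r := by
        intro i
        induction i with
        | zero => exact fun _ h => h
        | succ i ih =>
          intro hi hlt
          refine ih (by omega) ?_
          by_contra! hle
          exact h1 ⟨i + 1, hi, hlt, by rwa [level_succ_div hδ hδ1]⟩
      exact Or.inl (Or.inl ⟨0, Nat.zero_le _, (level_zero δ u₀).symm,
        (h3 j le_rfl (not_le.1 h2)).le, fun h => absurd h (lt_irrefl _)⟩)
  unfold quantizer
  split_ifs with h
  · rcases key r h with h1 | ⟨h1, h2⟩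
    · exact Or.inl h1
    · exact Or.inr (Or.inr ⟨h1, by show -_ ≤ r; linarith, h2⟩)
  · rcases key (-r) (by linarith) with h1 | ⟨h1, h2⟩
    · exact Or.inr (Or.inl (by rwa [neg_neg]))
    · exact Or.inr (Or.inr ⟨by rw [h1, neg_zero], by show -_ ≤ r; linarith,
        by show r ≤ _; linarith⟩)

/-- Induction along an interval, with steps to the right and limits from the left. -/
theorem forall_Icc_of_left_right {J : ℝ → Prop} {t₁ : ℝ} (h0 : J 0)
    (hl : ∀ t ∈ Ioc 0 t₁, (∀ r ∈ Ico 0 t, J r) → J t)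
    (hr : ∀ t ∈ Ico 0 t₁, J t → ∀ᶠ r in 𝓝[>] t, J r) : ∀ t ∈ Icc 0 t₁, J t := by
  by_contra! hcon
  obtain ⟨t, ht, hJt⟩ := hcon
  set B : Set ℝ := {t | t ∈ Icc 0 t₁ ∧ ¬ J t}
  have hBne : B.Nonempty := ⟨t, ht, hJt⟩
  have hBbd : BddBelow B := ⟨0, fun r hr => hr.1.1⟩
  set c := sInf B
  have hc0 : 0 ≤ c := le_csInf hBne fun r hr => hr.1.1
  have hct : c ≤ t := csInf_le hBbd ⟨ht, hJt⟩
  have hbelow : ∀ r ∈ Ico 0 c, J r := fun r hr => by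
    by_contra hJ
    exact absurd (csInf_le hBbd ⟨⟨hr.1, hr.2.le.trans (hct.trans ht.2)⟩, hJ⟩) (not_le.2 hr.2)
  have hJc : J c := by
    rcases hc0.eq_or_lt with h | h
    · rw [← h]; exact h0
    · exact hl c ⟨h, hct.trans ht.2⟩ hbelow
  have hct' : c < t := lt_of_le_of_ne hct fun h => hJt (h ▸ hJc)
  obtain ⟨d, hd, hdJ⟩ := (mem_nhdsGT_iff_exists_Ioo_subset' hct').1
    (hr c ⟨hc0, hct'.trans_le ht.2⟩ hJc)
  obtain ⟨r, hrB, hrd⟩ := exists_lt_of_csInf_lt hBne (show sInf B < d from hd)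
  have hcr : c ≤ r := csInf_le hBbd hrB
  rcases hcr.eq_or_lt with h | h
  · exact hrB.2 (h ▸ hJc)
  · exact hrB.2 (hdJ ⟨h, hrd⟩)

end Hysteresis

section Closed

variable {m s : ℕ} {f : (Fin m → ℝ) × ℝ → (Fin m → ℝ)} {q b : State m (s + 1) → ℝ} {a : Fin s → ℝ}

/-- Compatibility of value and input is invariant in time: closed regions pass to limits from the
left, open ones extend to the right after each update. -/
theorem IsSwitchedTrajectory.hysteresisRegion {E : Type*} [NormedAddCommGroup E] [NormedSpace ℝ E]
    {δ u₀ : ℝ} {j : ℕ} (hδ : 0 < δ) (hδ1 : δ < 1) (hu : 0 < u₀) {g : E → ℝ → E} {y : E → ℝ}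
    (hy : Continuous y) {τ : EReal} {φ : ℝ → E} {w : ℝ → ℝ}
    (h : IsSwitchedTrajectory g y (quantizer δ u₀ j) (hysteresisNext δ u₀ j) τ φ w) {t : ℝ}
    (h0 : 0 ≤ t) (hτ : (t : EReal) < τ) :
    HysteresisRegion (· ≤ ·) δ u₀ j (w t) (y (φ t)) := by
  have hlt : ∀ r ≤ t, (r : EReal) < τ := fun r hr => (EReal.coe_le_coe_iff.2 hr).trans_lt hτ
  refine forall_Icc_of_left_right (J := fun t => HysteresisRegion (· ≤ ·) δ u₀ j (w t) (y (φ t)))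
    (t₁ := t) ?_ (fun r hr hall => ?_) (fun r hr hJ => ?_) t ⟨h0, le_rfl⟩
  · rw [h.initial]; exact hysteresisRegion_quantizer hδ hδ1 _
  · refine (isClosed_hysteresisRegion (w r)).mem_of_tendsto
      ((hy.tendsto _).comp (h.tendsto_left hr.1 (hlt r hr.2))) ?_
    filter_upwards [h.left r hr.1 (hlt r hr.2), Ico_mem_nhdsLT hr.1] with r' h1 h2
    have := hall r' h2
    rwa [h1] at this
  · obtain ⟨w', hw', hev⟩ := h.right r hr.1 (hlt r hr.2.le)
    have hreg := hw'.hysteresisRegion hδ hδ1 hu hJ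
    have hright : Tendsto φ (𝓝[>] r) (𝓝 (φ r)) := by
      rw [← nhdsWithin_Ioc_eq_nhdsGT hr.2]
      exact (h.continuousOn h0 hτ r ⟨hr.1, hr.2.le⟩).mono_left
        (nhdsWithin_mono _ fun x hx => ⟨hr.1.trans hx.1.le, hx.2⟩)
    filter_upwards [hev, ((hy.tendsto _).comp hright).eventually hreg.eventually] with r' h1 h2
    rw [h1]
    exact h2.mono

theorem IsHysteresisTrajectory.isPushedTrajectory {b₀ : ℝ} (hb₀ : 0 < b₀) (hb : ∀ p, b₀ ≤ b p)
    {δ u₀ k η C : ℝ} {j : ℕ} (hδ : 0 < δ) (hδ1 : δ < 1) (hu : 0 < u₀) (hk : 0 < k) (hC : 0 ≤ C)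
    (hlevel : level δ u₀ j / (1 + δ) < k * η) (hgain : C / b₀ ≤ (1 - δ) * (k * η))
    (hmax : C / b₀ ≤ u₀) {τ : EReal} {φ : ℝ → State m (s + 1)}
    (h : IsHysteresisTrajectory f q b a δ u₀ j k τ φ) : IsPushedTrajectory f q a η C τ φ := by
  obtain ⟨w, h⟩ := h
  refine ⟨h.absCont, ?_⟩
  filter_upwards [h.ode] with t ht h0 hτ
  have hreg := h.hysteresisRegion hδ hδ1 hu ((continuous_zeta a).const_mul k) h0.le hτ
  have hbC : ∀ (p : State m (s + 1)) (v r : ℝ), k * η < r → min ((1 - δ) * r) u₀ ≤ v →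
      C ≤ b p * v := fun p v r hr hv => by
    have hn : 0 < 1 - δ := by linarith
    have h1 : C / b₀ ≤ v := by
      refine le_trans (le_min (hgain.trans ?_) hmax) hv
      exact mul_le_mul_of_nonneg_left hr.le hn.le
    have h2 : 0 ≤ v := (by positivity : 0 ≤ C / b₀).trans h1
    rw [div_le_iff₀ hb₀] at h1
    nlinarith [hb p]
  refine ⟨_, ht h0 hτ, fun hlt => ?_, fun hlt => ?_⟩
  · have hr : k * η < k * zeta a (φ t) := mul_lt_mul_of_pos_left hlt hk
    have := hbC (φ t) _ _ hr (hreg.le_value hδ hδ1 hu (hlevel.trans hr))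
    linarith
  · have hr : k * η < -(k * zeta a (φ t)) := by
      have := mul_lt_mul_of_pos_left hlt hk
      linarith
    have := hbC (φ t) _ _ hr
      ((hreg.neg fun _ _ h => neg_le_neg h).le_value hδ hδ1 hu (hlevel.trans hr))
    linarith

end Closed

end QuantizedControl

/-! ### Choice of the parameters and conclusion -/

namespace QuantizedControl

/-- The parameters of a quantizer that is strong enough outside a small dead zone. -/
theorem exists_quantizer_parameters {δ η C b₀ Z : ℝ} (hδ : 0 < δ) (hδ1 : δ < 1) (hη : 0 < η)
    (hC : 0 < C) (hb₀ : 0 < b₀) (hZ : 0 < Z) :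
    ∃ (k u₀ : ℝ) (j : ℕ), 0 < k ∧ 0 < u₀ ∧ level δ u₀ j / (1 + δ) < k * η / 2 ∧
      C / b₀ ≤ (1 - δ) * (k * η / 2) ∧ C / b₀ ≤ u₀ ∧ k * Z < u₀ / (1 - δ) := by
  have hn : 0 < 1 - δ := by linarith
  -- This makes `(1 - δ) * (k * η / 2)` equal to `C / b₀`.
  set k := 2 * (C / b₀) / ((1 - δ) * η)
  have hk : 0 < k := by positivity
  -- One summand gives the required strength, the other the range. The index `j` comes last, since
  -- the dead zone has to be small relative to `k` and `u₀`.
  set u₀ := C / b₀ + k * Z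
  have hu : 0 < u₀ := by positivity
  obtain ⟨j, hj⟩ := exists_level_lt hδ hδ1 hu (v := k * η / 2) (by positivity)
  refine ⟨k, u₀, j, hk, hu, hj, ?_, ?_, ?_⟩
  · have : (1 - δ) * (k * η / 2) = C / b₀ := by
      simp only [k]; field_simp
    exact this.ge
  · have : 0 < k * Z := by positivity
    linarith
  · have h1 : 0 < C / b₀ := by positivity
    rw [lt_div_iff₀ hn]
    nlinarith [mul_pos (mul_pos hk hZ) hδ]

theorem practicallyStable_of_pushed {m s : ℕ} {f : (Fin m → ℝ) × ℝ → (Fin m → ℝ)}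
    {q : State m (s + 1) → ℝ} {a : Fin s → ℝ} {η C T M R ε Z : ℝ}
    (h : ∀ (τ : EReal) (φ : ℝ → State m (s + 1)), IsPushedTrajectory f q a η C τ φ →
      φ 0 ∈ cube R → ∀ t : ℝ, 0 ≤ t → (t : EReal) < τ →
        φ t ∈ cube M ∧ |zeta a (φ t)| ≤ Z ∧ (T ≤ t → φ t ∈ cube ε)) (hT : 0 < T)
    {trajectory : EReal → (ℝ → State m (s + 1)) → Prop}
    (htr : ∀ τ φ, trajectory τ φ → IsPushedTrajectory f q a η C τ φ) :
    PracticallyStable trajectory R ε T :=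
  ⟨⟨M, fun τ φ hφ h0 t ht hτ => (h τ φ (htr τ φ hφ) h0 t ht hτ).1⟩,
    fun τ φ hφ h0 t ht hτ => (h τ φ (htr τ φ hφ) h0 t (hT.le.trans ht) hτ).2.2 ht⟩

theorem staysInRange_of_pushed {m s : ℕ} {f : (Fin m → ℝ) × ℝ → (Fin m → ℝ)}
    {q : State m (s + 1) → ℝ} {a : Fin s → ℝ} {η C T M R ε Z : ℝ}
    (h : ∀ (τ : EReal) (φ : ℝ → State m (s + 1)), IsPushedTrajectory f q a η C τ φ →
      φ 0 ∈ cube R → ∀ t : ℝ, 0 ≤ t → (t : EReal) < τ →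
        φ t ∈ cube M ∧ |zeta a (φ t)| ≤ Z ∧ (T ≤ t → φ t ∈ cube ε))
    {trajectory : EReal → (ℝ → State m (s + 1)) → Prop}
    (htr : ∀ τ φ, trajectory τ φ → IsPushedTrajectory f q a η C τ φ) {k δ u₀ : ℝ} (hk : 0 < k)
    (hZ : k * Z < u₀ / (1 - δ)) : StaysInRange trajectory a k δ u₀ R := by
  intro τ φ hφ h0 t ht hτ
  rw [abs_mul, abs_of_pos hk]
  exact (mul_le_mul_of_nonneg_left (h τ φ (htr τ φ hφ) h0 t ht hτ).2.1 hk.le).trans_lt hZ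

end QuantizedControl

open QuantizedControl
theorem proposition4 {m s : ℕ}
    (f : (Fin m → ℝ) × ℝ → (Fin m → ℝ)) (q b : State m (s + 1) → ℝ)
    (hf : LocallyLipschitz f) (hq : LocallyLipschitz q) (hb : LocallyLipschitz b)
    (b₀ : ℝ) (hb₀ : 0 < b₀) (hbb₀ : ∀ p, b₀ ≤ b p)
    (hmin : IsMinimumPhase f) (R : ℝ) (hR : 0 < R) :
    ∃ a : Fin s → ℝ, AttractedFrom (reducedField f a) (cube R) ∧
      ∀ ε : ℝ, 0 < ε →
        (∀ δ : ℝ, 0 < δ → δ < 1 → ∃ (k u₀ : ℝ) (j : ℕ) (T : ℝ), 0 < k ∧ 0 < u₀ ∧ 0 < T ∧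
          StaysInRange (IsQuantizedTrajectory f q b a δ u₀ j k) a k δ u₀ R ∧
          PracticallyStable (IsQuantizedTrajectory f q b a δ u₀ j k) R ε T) ∧
        (∀ δ : ℝ, 0 < δ → δ < 1 → ∃ (k u₀ : ℝ) (j : ℕ) (T : ℝ), 0 < k ∧ 0 < u₀ ∧ 0 < T ∧
          StaysInRange (IsHysteresisTrajectory f q b a δ u₀ j k) a k δ u₀ R ∧
          PracticallyStable (IsHysteresisTrajectory f q b a δ u₀ j k) R ε T) ∧
        (∃ k η T : ℝ, 0 < k ∧ 0 < η ∧ 0 < T ∧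
          PracticallyStable (IsTernaryTrajectory f q b a k η) R ε T) := by
  obtain ⟨a, hatt, Z, hZ, hpush⟩ := exists_gain_pushed (s := s) hf hq.continuous hmin hR
  refine ⟨a, hatt, fun ε hε => ?_⟩
  obtain ⟨η, hη, C, hC, T, hT, M, h⟩ := hpush ε hε
  refine ⟨fun δ hδ hδ1 => ?_, fun δ hδ hδ1 => ?_, C / b₀, η, T, by positivity, hη, hT,
    practicallyStable_of_pushed h hT fun τ φ hφ => hφ.isPushedTrajectory hb₀ hbb₀ hη hC⟩
  · obtain ⟨k, u₀, j, hk, hu, hlevel, hgain, hmax, hrange⟩ :=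
      exists_quantizer_parameters hδ hδ1 hη hC hb₀ hZ
    have hΨ : ∀ v, k * η / 2 < v → C / b₀ ≤ quantizer δ u₀ j v := fun v hv => by
      have hn : 0 ≤ 1 - δ := by linarith
      exact (le_min (hgain.trans (mul_le_mul_of_nonneg_left hv.le hn)) hmax).trans
        (le_quantizer hδ hδ1 hu (hlevel.trans hv))
    have htr : ∀ τ φ, IsQuantizedTrajectory f q b a δ u₀ j k τ φ →
        IsPushedTrajectory f q a η C τ φ := fun τ φ hφ =>
      hφ.isPushedTrajectory hf.continuous hq.continuous hb₀ hbb₀ hk hη hC.le hΨ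
    exact ⟨k, u₀, j, T, hk, hu, hT, staysInRange_of_pushed h htr hk hrange,
      practicallyStable_of_pushed h hT htr⟩
  · obtain ⟨k, u₀, j, hk, hu, hlevel, hgain, hmax, hrange⟩ :=
      exists_quantizer_parameters hδ hδ1 hη hC hb₀ hZ
    have hkη : 0 < k * η := by positivity
    -- Here the value of the control at the current state counts, so the threshold is `k * η`; the
    -- conditions at `k * η / 2` imply those needed.
    have htr : ∀ τ φ, IsHysteresisTrajectory f q b a δ u₀ j k τ φ →
        IsPushedTrajectory f q a η C τ φ := fun τ φ hφ =>
      hφ.isPushedTrajectory hb₀ hbb₀ hδ hδ1 hu hk hC.le (by linarith)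
        (hgain.trans (mul_le_mul_of_nonneg_left (by linarith) (by linarith))) hmax
    exact ⟨k, u₀, j, T, hk, hu, hT, staysInRange_of_pushed h htr hk hrange,
      practicallyStable_of_pushed h hT htr⟩
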